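/- Let $d,n\ge 1$ and let $|\tau_1\rangle,\dots,|\tau_m\rangle\in\mathbb{C}^d$ be unit vectors forming a spherical 2-design, i.e. $\frac1m\sum_{i=1}^m(|\tau_i\rangle\langle\tau_i|)^{\otimes 2}=\frac{2}{d(d+1)}\Pi_+$, where $\Pi_+$ is the projector onto the symmetric subspace of $\mathbb{C}^d\otimes\mathbb{C}^d$. Let $|\Omega\rangle=m^{-1/2}\sum_{i=1}^m|i\rangle\otimes|\tau_i\rangle^{\otimes n}\in\mathbb{C}^m\otimes(\mathbb{C}^d)^{\otimes n}$ and $\omega=|\Omega\rangle\langle\Omega|$ (a density matrix). 1. The map $U\mapsto(\mathbb{1}_A\otimes U^{\otimes n})|\Omega\rangle$ on $SU(d)$ is injective up to multiplicative phases: for $U_1,U_2\in SU(d)$, the vectors $(\mathbb{1}_A\otimes U_1^{\otimes n})|\Omega\rangle$ and $(\mathbb{1}_A\otimes U_2^{\otimes n})|\Omega\rangle$ are equal up to a scalar factor if and only if $U_1=\zeta U_2$ for some scalar $\zeta$; they are equal if and only if $U_1=\zeta U_2$ for some $\zeta$ with $\zeta^n=1$. In particular, the map is injective on $SU(d)$ itself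 if and only if $\gcd(n,d)=1$. 2. For an input density matrix $\omega'$ on $\mathbb{C}^{d_A}\otimes(\mathbb{C}^d)^{\otimes n}$ ($d_A$ arbitrary) and a parametrization $\theta\mapsto U(\theta)\in SU(d)$, $\theta\in\mathbb{R}^{d^2-1}$, put $\rho(\theta)=\big[(\mathbb{1}_A\otimes U(\theta)^{\otimes n})\,\omega'\,(\mathbb{1}_A\otimes U(\theta)^{\otimes n})^\dagger\big]^{\otimes N}$; for a discrete POVM $M=\{M_\xi\}$ on the $N$ output systems let $I^{[N]}(M)$ be its Fisher information at $\theta$, $I^{[N]}_{\alpha\beta}(M)=\sum_{\xi:\,\mathrm{tr}[\rho M_\xi]>0}\frac{\mathrm{tr}[\partial_\alpha\rho\, M_\xi]\,\mathrm{tr}[\partial_\beta\rho\, M_\xi]}{\mathrm{tr}[\rho M_\xi]}$, and let $C_n(\theta,\omega',\mathbb{I})=\liminf_{N\to\infty}N\inf_M\mathrm{Tr}\,[I^{[N]}(M)]^{-1}$, where $\mathrm{Tr}\,I^{-1}=\infty$ if $I$ is singular. Suppose that $U$ is differentiable at $\theta$ and that $t_\alpha=iU^\dagger\partial_\alpha U$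 satisfies $\mathrm{tr}\,t_\alpha t_\beta=\delta_{\alpha\beta}$ at $\theta$. Then, for $\omega$, the lower limit is a limit and $$C_n(\theta,\omega,\mathbb{I})=\frac{d(d+1)^2(d-1)}{4n(n+d)},$$ so that the error is of order $1/n^2$, and this is optimal: $C_n(\theta,\omega',\mathbb{I})\ge\frac{d(d+1)^2(d-1)}{4n(n+d)}$ for every ancilla dimension $d_A$ and every input density matrix $\omega'$, mixed or pure. -/

import Mathlib

open Matrix Filter Topology
open scoped Kronecker ENNReal ComplexOrder

namespace SUEstimation

noncomputable section

/-- The tensor power `A^{⊗n}`, as a matrix in the product basis `|x₁ … xₙ⟩`, `x : Fin n → ι`. -/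
def tensorPow {ι : Type} (n : ℕ) (A : Matrix ι ι ℂ) : Matrix (Fin n → ι) (Fin n → ι) ℂ :=
  Matrix.of fun x y => ∏ k, A (x k) (y k)

/-- The rank one operator `|v⟩⟨v|`. -/
def ketbra {ι : Type} (v : ι → ℂ) : Matrix ι ι ℂ := vecMulVec v (star v)

/-- The swap operator `W : ψ ⊗ φ ↦ φ ⊗ ψ` on `ℂ^d ⊗ ℂ^d`. -/
def swapMatrix (d : ℕ) : Matrix (Fin d × Fin d) (Fin d × Fin d) ℂ :=
  Matrix.of fun x y => if x = y.swap then 1 else 0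

/-- The projector `Π₊ = (𝟙 + W)/2` onto the symmetric subspace of `ℂ^d ⊗ ℂ^d`. -/
def symProj (d : ℕ) : Matrix (Fin d × Fin d) (Fin d × Fin d) ℂ :=
  (1 / 2 : ℂ) • (1 + swapMatrix d)

/-- State vectors `τ₁, …, τ_m` of `ℂ^d` form a (complex, spherical) 2-design:
`(1/m) ∑ᵢ (|τᵢ⟩⟨τᵢ|)^{⊗2} = 2 Π₊ / (d (d+1))`. -/
structure IsTwoDesign {d m : ℕ} (τ : Fin m → EuclideanSpace ℂ (Fin d)) : Prop where
  norm_eq_one : ∀ i, ‖τ i‖ = 1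
  average : (1 / (m : ℂ)) • ∑ i, ketbra (τ i) ⊗ₖ ketbra (τ i) =
    (2 / ((d : ℂ) * (d + 1))) • symProj d

/-- The Hilbert space `ℂ^{dA} ⊗ (ℂ^d)^{⊗n}` has the product basis `|i⟩ ⊗ |x₁ … xₙ⟩`. -/
abbrev Idx (dA d n : ℕ) : Type := Fin dA × (Fin n → Fin d)

/-- The input vector `|Ω⟩ = m^{-1/2} ∑ᵢ |i⟩ ⊗ |τᵢ⟩^{⊗n}`. -/
def inputVec {d m : ℕ} (n : ℕ) (τ : Fin m → EuclideanSpace ℂ (Fin d)) : Idx m d n → ℂ :=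
  fun ix => (1 / (Real.sqrt m : ℂ)) * ∏ k, τ ix.1 (ix.2 k)

/-- The operator `𝟙_A ⊗ U^{⊗n}`. -/
def gate {d : ℕ} (dA n : ℕ) (U : Matrix (Fin d) (Fin d) ℂ) :
    Matrix (Idx dA d n) (Idx dA d n) ℂ :=
  (1 : Matrix (Fin dA) (Fin dA) ℂ) ⊗ₖ tensorPow n U

/-- The output vector `(𝟙_A ⊗ U^{⊗n})|Ω⟩`. -/
def outputVec {d m : ℕ} (n : ℕ) (τ : Fin m → EuclideanSpace ℂ (Fin d))
    (U : specialUnitaryGroup (Fin d) ℂ) : Idx m d n → ℂ :=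
  gate m n (U : Matrix (Fin d) (Fin d) ℂ) *ᵥ inputVec n τ

/-- Density matrices. -/
structure IsDensity {ι : Type} [Fintype ι] (ω : Matrix ι ι ℂ) : Prop where
  posSemidef : ω.PosSemidef
  trace_eq_one : ω.trace = 1

/-- A POVM with a discrete outcome space, indexed by `ℕ`
(finitely many outcomes are the case where all but finitely many elements vanish). -/
structure POVM (ι : Type) [Fintype ι] [DecidableEq ι] where
  elt : ℕ → Matrix ι ι ℂ
  posSemidef : ∀ ξ, (elt ξ).PosSemidef
  hasSum_one : ∀ a b, HasSum (fun ξ => elt ξ a b) ((1 : Matrix ι ι ℂ) a b)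

/-- The entrywise partial derivative `∂A/∂θ_α` at `θ` of a matrix valued function of `θ`. -/
def pderiv {p : ℕ} {ι : Type} (A : (Fin p → ℝ) → Matrix ι ι ℂ) (θ : Fin p → ℝ) (α : Fin p) :
    Matrix ι ι ℂ :=
  Matrix.of fun a b => lineDeriv ℝ (fun θ' => A θ' a b) θ (Pi.single α 1)

/-- The Fisher information at `θ` of the measurement `M` in the model `ρ`: the sum over the
outcomes `ξ` of positive probability of `tr[ρ_{,α} M_ξ] tr[ρ_{,β} M_ξ] / tr[ρ M_ξ]`
(all these traces are real). -/
def fisherInfo {p : ℕ} {ι : Type} [Fintype ι] [DecidableEq ι]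
    (ρ : (Fin p → ℝ) → Matrix ι ι ℂ) (θ : Fin p → ℝ) (M : POVM ι) :
    Matrix (Fin p) (Fin p) ℝ :=
  Matrix.of fun α β => ∑' ξ,
    if 0 < (ρ θ * M.elt ξ).trace.re then
      (pderiv ρ θ α * M.elt ξ).trace.re * (pderiv ρ θ β * M.elt ξ).trace.re
        / (ρ θ * M.elt ξ).trace.re
    else 0

open Classical in
/-- `Tr I⁻¹` for an information matrix `I`, with the value `∞` if `I` is singular. -/
def traceInv {p : ℕ} (I : Matrix (Fin p) (Fin p) ℝ) : ℝ≥0∞ :=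
  if IsUnit I.det then ENNReal.ofReal (I⁻¹).trace else ∞

/-- `ρ_n(θ, ω)^{[N]} = ((𝟙_A ⊗ U(θ)^{⊗n}) ω (𝟙_A ⊗ U(θ)^{⊗n})†)^{⊗N}`. -/
def outputModel {p d dA : ℕ} (n N : ℕ) (U : (Fin p → ℝ) → specialUnitaryGroup (Fin d) ℂ)
    (ω : Matrix (Idx dA d n) (Idx dA d n) ℂ) (θ : Fin p → ℝ) :
    Matrix (Fin N → Idx dA d n) (Fin N → Idx dA d n) ℂ :=
  tensorPow N (gate dA n (U θ : Matrix (Fin d) (Fin d) ℂ) * ω *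
    (gate dA n (U θ : Matrix (Fin d) (Fin d) ℂ))ᴴ)

/-- `N · inf_M Tr [I_n(θ, M, ω)^{[N]}]⁻¹`, over all (collective) measurements `M` on the `N`
output systems. -/
def scaledError {p d dA : ℕ} (n N : ℕ) (U : (Fin p → ℝ) → specialUnitaryGroup (Fin d) ℂ)
    (θ : Fin p → ℝ) (ω : Matrix (Idx dA d n) (Idx dA d n) ℂ) : ℝ≥0∞ :=
  (N : ℝ≥0∞) * ⨅ M : POVM (Fin N → Idx dA d n), traceInv (fisherInfo (outputModel n N U ω) θ M)

/-- The asymptotic figure of merit `C_n(θ, ω, 𝕀)`, the limit of `scaledError` as `N → ∞`;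
the lower limit makes the definition unconditional. -/
def figureOfMerit {p d dA : ℕ} (n : ℕ) (U : (Fin p → ℝ) → specialUnitaryGroup (Fin d) ℂ)
    (θ : Fin p → ℝ) (ω : Matrix (Idx dA d n) (Idx dA d n) ℂ) : ℝ≥0∞ :=
  liminf (fun N : ℕ => scaledError n N U θ ω) atTop

/-- `t_α = i U† ∂_α U` at `θ`. -/
def generator {p d : ℕ} (U : (Fin p → ℝ) → specialUnitaryGroup (Fin d) ℂ) (θ : Fin p → ℝ)
    (α : Fin p) : Matrix (Fin d) (Fin d) ℂ :=
  Complex.I • ((U θ : Matrix (Fin d) (Fin d) ℂ)ᴴ *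
    pderiv (fun θ' => (U θ' : Matrix (Fin d) (Fin d) ℂ)) θ α)

/-- `U` is a parametrization of `SU(d)` by `d² - 1` real parameters that is differentiable at `θ`
and normalized there by `tr (t_α t_β) = δ_{αβ}`. -/
structure IsNormalizedAt {d : ℕ} (U : (Fin (d ^ 2 - 1) → ℝ) → specialUnitaryGroup (Fin d) ℂ)
    (θ : Fin (d ^ 2 - 1) → ℝ) : Prop where
  differentiableAt : ∀ a b,
    DifferentiableAt ℝ (fun θ' => (U θ' : Matrix (Fin d) (Fin d) ℂ) a b) θ
  trace_mul : ∀ α β, (generator U θ α * generator U θ β).trace = if α = β then 1 else 0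

end

end SUEstimation

/-!
Write `s_α = i ∂_αU U†`; differentiating `U U† = 𝟙` and `det U = 1` shows that the `s_α` are
Hermitian and traceless, and the normalization makes them an orthonormal basis of the traceless
Hermitian matrices, so that `∑ s_α ⊗ s_α = W - 𝟙 / d` (`IsGeneratorBasis.completeness`). With
`S_α = 𝟙_A ⊗ ∑ₖ s_α⁽ᵏ⁾`, the output state `σ` of one system satisfies `∂_ασ = L_α σ + σ L_α†` for
`L_α = -i (S_α - tr (S_α σ))`, and the `N`-copy model `ρ` satisfies the same equation with the
collective operator `𝓛_α = ∑ᵢ L_α⁽ⁱ⁾` (`pderiv_outputModel`). Since `tr (L_α σ) = 0`, the copies do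
not interfere: `tr (𝓛_α ρ 𝓛_β†) = N tr (L_α σ L_β†)`.

*Lower bound.* By the Cauchy–Schwarz inequality, outcome by outcome, every measurement has
`I_αα ≤ 4 tr (𝓛_α ρ 𝓛_α†) ≤ 4 N tr (S_α σ S_α)` (`fisherInfo_diag_le`). The sum of `S_α²` is the
Casimir operator, which the completeness relation expresses by the swaps of pairs of tensor factors;
as a swap is at most `𝟙`, the sum is at most `n (n + d) (d - 1) / d`
(`IsGeneratorBasis.casimir_le`). This bounds `tr I`, and the inequality of arithmetic and harmonic
means gives `tr I⁻¹ ≥ (d² - 1)² / tr I` (`le_traceInv`). No quantum Fisher information matrix is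
needed, and nothing is assumed about the input state.

*Attainability.* For the design input, the first two moments of the design give `tr (S_α σ) = 0`
and `tr (S_α σ S_β) = δ_αβ n (n + d) / (d (d + 1))`. Hence the `N`-copy vector `Ψ` and its
derivatives `𝓛_α Ψ` are orthogonal, and the Gram matrix is real. Measuring in an orthonormal basis
of their real span in which no coordinate of `Ψ` vanishes has the Fisher information
`4 N n (n + d) / (d (d + 1)) 𝟙` (`exists_fisherInfo_eq`). So both bounds hold with equality for
every `N ≥ 1`.

*Injectivity.* If two outputs are proportional, then `V = U₂† U₁` commutes with all projectors
`|τᵢ⟩⟨τᵢ|`. The second moment of the pair `V`, `Y` is then a first moment of `V Y`, which gives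
`tr V tr Y = d tr (V Y)` for all `Y`, so that `V` is a scalar (`HasDesignMoments.eq_smul_one`).
-/

namespace SUEstimation

/-! ### Tensor products of operators and their traces -/

section Tensor

variable {ι : Type} {N : ℕ}

/-- The tensor product `A₁ ⊗ ⋯ ⊗ A_N` in the product basis. -/
def tensorProd (A : Fin N → Matrix ι ι ℂ) : Matrix (Fin N → ι) (Fin N → ι) ℂ :=
  Matrix.of fun x y => ∏ k, A k (x k) (y k)

lemma tensorPow_eq (A : Matrix ι ι ℂ) : tensorPow N A = tensorProd fun _ => A := rfl

/-- `∑ᵢ B ⊗ ⋯ ⊗ C ⊗ ⋯ ⊗ B` with `C` in position `i`: the derivative of the tensor power at `B` in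
the direction `C`. -/
def tensorDer (N : ℕ) (B C : Matrix ι ι ℂ) : Matrix (Fin N → ι) (Fin N → ι) ℂ :=
  ∑ i, tensorProd (Function.update (fun _ => B) i C)

lemma conjTranspose_tensorProd (A : Fin N → Matrix ι ι ℂ) :
    (tensorProd A)ᴴ = tensorProd fun k => (A k)ᴴ := by
  ext x y
  simp [tensorProd]

lemma conjTranspose_tensorPow (A : Matrix ι ι ℂ) : (tensorPow N A)ᴴ = tensorPow N Aᴴ :=
  conjTranspose_tensorProd _

lemma tensorProd_update_apply (B : Fin N → Matrix ι ι ℂ) (i : Fin N) (C : Matrix ι ι ℂ)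
    (x y : Fin N → ι) : tensorProd (Function.update B i C) x y =
      C (x i) (y i) * ∏ k ∈ Finset.univ.erase i, B k (x k) (y k) := by
  rw [tensorProd, of_apply, ← Finset.mul_prod_erase _ _ (Finset.mem_univ i), Function.update_self]
  refine congrArg _ (Finset.prod_congr rfl fun k hk => ?_)
  rw [Function.update_of_ne (Finset.ne_of_mem_erase hk)]

lemma tensorProd_update_add (B : Fin N → Matrix ι ι ℂ) (i : Fin N) (C D : Matrix ι ι ℂ) :
    tensorProd (Function.update B i (C + D)) =
      tensorProd (Function.update B i C) + tensorProd (Function.update B i D) := by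
  ext x y
  simp only [tensorProd_update_apply, Matrix.add_apply, add_mul]

lemma tensorDer_add (B C D : Matrix ι ι ℂ) :
    tensorDer N B (C + D) = tensorDer N B C + tensorDer N B D := by
  simp only [tensorDer, tensorProd_update_add, Finset.sum_add_distrib]

lemma conjTranspose_tensorDer (B C : Matrix ι ι ℂ) :
    (tensorDer N B C)ᴴ = tensorDer N Bᴴ Cᴴ := by
  simp only [tensorDer, conjTranspose_sum, conjTranspose_tensorProd]
  refine Finset.sum_congr rfl fun i _ => congrArg _ (funext fun k => ?_)
  by_cases h : k = i
  · subst h; simp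
  · simp [h]

/-- The collective operator `∑ᵢ X⁽ⁱ⁾`, with `X⁽ⁱ⁾` acting on the `i`-th tensor factor. -/
def tensorSum [DecidableEq ι] (N : ℕ) (X : Matrix ι ι ℂ) :
    Matrix (Fin N → ι) (Fin N → ι) ℂ := tensorDer N 1 X

lemma tensorPow_one [DecidableEq ι] : tensorPow N (1 : Matrix ι ι ℂ) = 1 := by
  ext x y
  simp only [tensorPow, of_apply, one_apply, Finset.prod_ite_zero, funext_iff]
  simp

lemma conjTranspose_tensorSum [DecidableEq ι] (X : Matrix ι ι ℂ) :
    (tensorSum N X)ᴴ = tensorSum N Xᴴ := by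
  simp [tensorSum, conjTranspose_tensorDer]

lemma tensorSum_smul [DecidableEq ι] (c : ℂ) (X : Matrix ι ι ℂ) :
    tensorSum N (c • X) = c • tensorSum N X := by
  simp only [tensorSum, tensorDer, Finset.smul_sum]
  refine Finset.sum_congr rfl fun i _ => ?_
  ext x y
  simp only [tensorProd_update_apply, Matrix.smul_apply, smul_eq_mul, mul_assoc]

lemma tensorPow_ketbra (v : ι → ℂ) :
    tensorPow N (ketbra v) = ketbra fun x : Fin N → ι => ∏ k, v (x k) := by
  ext x y
  simp [tensorPow, ketbra, vecMulVec_apply, Finset.prod_mul_distrib]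

variable [Fintype ι]

lemma tensorProd_mul (A B : Fin N → Matrix ι ι ℂ) :
    tensorProd A * tensorProd B = tensorProd fun k => A k * B k := by
  ext x y
  simp only [tensorProd, mul_apply, of_apply, ← Finset.prod_mul_distrib, Finset.prod_univ_sum,
    Fintype.piFinset_univ]

lemma tensorPow_mul (A B : Matrix ι ι ℂ) :
    tensorPow N A * tensorPow N B = tensorPow N (A * B) :=
  tensorProd_mul _ _

lemma trace_tensorProd (A : Fin N → Matrix ι ι ℂ) : (tensorProd A).trace = ∏ k, (A k).trace := by
  simp only [tensorProd, trace, diag_apply, of_apply, Finset.prod_univ_sum, Fintype.piFinset_univ]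

lemma trace_tensorPow (A : Matrix ι ι ℂ) : (tensorPow N A).trace = A.trace ^ N := by
  simp [tensorPow_eq, trace_tensorProd]

variable [DecidableEq ι]

lemma tensorDer_mul_left (X B : Matrix ι ι ℂ) :
    tensorDer N B (X * B) = tensorSum N X * tensorPow N B := by
  simp only [tensorSum, tensorDer, Finset.sum_mul, tensorPow_eq, tensorProd_mul]
  refine Finset.sum_congr rfl fun i _ => congrArg _ (funext fun k => ?_)
  by_cases h : k = i
  · subst h; simp
  · simp [h]

lemma tensorDer_mul_right (X B : Matrix ι ι ℂ) :
    tensorDer N B (B * X) = tensorPow N B * tensorSum N X := by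
  simp only [tensorSum, tensorDer, Finset.mul_sum, tensorPow_eq, tensorProd_mul]
  refine Finset.sum_congr rfl fun i _ => congrArg _ (funext fun k => ?_)
  by_cases h : k = i
  · subst h; simp
  · simp [h]

lemma trace_tensorSum_mul {σ : Matrix ι ι ℂ} (hσ : σ.trace = 1) (X : Matrix ι ι ℂ) :
    (tensorSum N X * tensorPow N σ).trace = N * (X * σ).trace := by
  rw [← tensorDer_mul_left, tensorDer, trace_sum]
  simp only [trace_tensorProd]
  have h (i : Fin N) :
      ∏ k, (Function.update (fun _ => σ) i (X * σ) k).trace = (X * σ).trace := by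
    rw [Finset.prod_eq_single i]
    · simp
    · intro k _ hk; simp [hk, hσ]
    · simp
  simp [h]

/-- Second moments of collective operators in a product state: only the diagonal terms see the
product `Y X`. -/
lemma trace_tensorSum_mul_mul {σ : Matrix ι ι ℂ} (hσ : σ.trace = 1) (X Y : Matrix ι ι ℂ) :
    (tensorSum N X * tensorPow N σ * tensorSum N Y).trace =
      N * (X * σ * Y).trace + N * (N - 1) * ((X * σ).trace * (σ * Y).trace) := by
  have h (i j : Fin N) :
      (tensorProd (Function.update (fun _ => (1 : Matrix ι ι ℂ)) i X) * tensorPow N σ *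
        tensorProd (Function.update (fun _ => (1 : Matrix ι ι ℂ)) j Y)).trace =
      (X * σ).trace * (σ * Y).trace +
        if i = j then (X * σ * Y).trace - (X * σ).trace * (σ * Y).trace else 0 := by
    rw [tensorPow_eq, tensorProd_mul, tensorProd_mul, trace_tensorProd]
    split_ifs with hij
    · subst hij
      rw [Finset.prod_eq_single i]
      · simp
      · intro k _ hk; simp [hk, hσ]
      · simp
    · rw [← Finset.prod_subset (Finset.subset_univ {i, j}), Finset.prod_pair hij]
      · simp [hij, Ne.symm hij]
      · intro k _ hk
        simp only [Finset.mem_insert, Finset.mem_singleton, not_or] at hk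
        simp [hk.1, hk.2, hσ]
  simp only [tensorSum, tensorDer, Finset.sum_mul, Finset.mul_sum, trace_sum, h,
    Finset.sum_add_distrib, Finset.sum_ite_eq', Finset.mem_univ, if_true,
    Finset.sum_const, Finset.card_univ, Fintype.card_fin, nsmul_eq_mul]
  ring

end Tensor

/-! ### Upper bounds on the Fisher information -/

section Fisher

variable {ι : Type} [Fintype ι]

lemma trace_mul_nonneg {A B : Matrix ι ι ℂ} (hA : A.PosSemidef) (hB : B.PosSemidef) :
    0 ≤ (A * B).trace := by
  classical
  open scoped MatrixOrder in
  obtain ⟨b, rfl⟩ := CStarAlgebra.nonneg_iff_eq_star_mul_self.mp hB.nonneg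
  rw [star_eq_conjTranspose, ← Matrix.mul_assoc, trace_mul_comm, ← Matrix.mul_assoc]
  exact (hA.mul_mul_conjTranspose_same b).trace_nonneg

lemma trace_mul_nonneg_re {A B : Matrix ι ι ℂ} (hA : A.PosSemidef) (hB : B.PosSemidef) :
    0 ≤ (A * B).trace.re :=
  (Complex.nonneg_iff.mp (trace_mul_nonneg hA hB)).1

lemma trace_conjTranspose_mul_mul {R M : Matrix ι ι ℂ} (hR : R.IsHermitian) (hM : M.IsHermitian)
    (L : Matrix ι ι ℂ) : (R * Lᴴ * M).trace = star (L * R * M).trace := by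
  rw [← trace_conjTranspose, conjTranspose_mul, conjTranspose_mul, hR, hM, trace_mul_comm]

/-- The Cauchy–Schwarz inequality for the semi-inner product `(A, B) ↦ tr (A R Bᴴ M)`, at the pair
`(L, 1)`. -/
lemma sq_trace_re_le {R M : Matrix ι ι ℂ} (hR : R.PosSemidef) (hM : M.PosSemidef)
    (L : Matrix ι ι ℂ) :
    (L * R * M).trace.re ^ 2 ≤ (L * R * Lᴴ * M).trace.re * (R * M).trace.re := by
  classical
  have h (x : ℝ) : 0 ≤ (R * M).trace.re * (x * x) + 2 * (L * R * M).trace.re * x +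
      (L * R * Lᴴ * M).trace.re := by
    have h1 := trace_mul_nonneg_re (hR.mul_mul_conjTranspose_same (L + (x : ℂ) • 1)) hM
    have h2 : (L + (x : ℂ) • 1) * R * (L + (x : ℂ) • 1)ᴴ * M =
        L * R * Lᴴ * M + (x : ℂ) • (L * R * M) + (x : ℂ) • (R * Lᴴ * M) +
          ((x * x : ℝ) : ℂ) • (R * M) := by
      simp only [conjTranspose_add, conjTranspose_smul, conjTranspose_one, Matrix.add_mul,
        Matrix.mul_add, Matrix.smul_mul, Matrix.mul_smul, Matrix.one_mul, Matrix.mul_one,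
        Complex.star_def, Complex.conj_ofReal, smul_smul, Complex.ofReal_mul, smul_add]
      abel
    rw [h2] at h1
    simp only [trace_add, trace_smul, Complex.add_re, smul_eq_mul, Complex.re_ofReal_mul,
      trace_conjTranspose_mul_mul hR.1 hM.1, Complex.star_def, Complex.conj_re] at h1
    linarith
  have := discrim_le_zero h
  rw [discrim] at this
  nlinarith

variable [DecidableEq ι]

lemma POVM.hasSum_trace (M : POVM ι) (A : Matrix ι ι ℂ) :
    HasSum (fun ξ => (A * M.elt ξ).trace) A.trace := by
  have h : HasSum (fun ξ => ∑ a, ∑ b, A a b * M.elt ξ b a)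
      (∑ a, ∑ b, A a b * (1 : Matrix ι ι ℂ) b a) :=
    hasSum_sum fun a _ => hasSum_sum fun b _ => (M.hasSum_one b a).mul_left _
  simpa [trace, mul_apply, one_apply] using h

variable {p : ℕ} {ρ : (Fin p → ℝ) → Matrix ι ι ℂ} {θ : Fin p → ℝ}
  {L : Fin p → Matrix ι ι ℂ}

/-- The classical score of the outcome `ξ` for the `α`-th parameter, scaled by the square root of
the probability of `ξ`, so that the Fisher information is the Gram matrix of these sequences. -/
noncomputable def score (ρ : (Fin p → ℝ) → Matrix ι ι ℂ) (θ : Fin p → ℝ) (M : POVM ι) (α : Fin p)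
    (ξ : ℕ) : ℝ :=
  if 0 < (ρ θ * M.elt ξ).trace.re then
    (pderiv ρ θ α * M.elt ξ).trace.re / Real.sqrt (ρ θ * M.elt ξ).trace.re else 0

lemma fisherInfo_apply (M : POVM ι) (α β : Fin p) :
    fisherInfo ρ θ M α β = ∑' ξ, score ρ θ M α ξ * score ρ θ M β ξ := by
  refine tsum_congr fun ξ => ?_
  simp only [score]
  split_ifs with h
  · rw [div_mul_div_comm, Real.mul_self_sqrt h.le]
  · simp

lemma sq_score_le (hρ : (ρ θ).PosSemidef)
    (hL : ∀ α, pderiv ρ θ α = L α * ρ θ + ρ θ * (L α)ᴴ) (M : POVM ι) (α : Fin p) (ξ : ℕ) :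
    score ρ θ M α ξ ^ 2 ≤ 4 * (L α * ρ θ * (L α)ᴴ * M.elt ξ).trace.re := by
  have h0 : 0 ≤ (L α * ρ θ * (L α)ᴴ * M.elt ξ).trace.re :=
    trace_mul_nonneg_re (hρ.mul_mul_conjTranspose_same _) (M.posSemidef ξ)
  rw [score]
  split_ifs with h
  · rw [div_pow, Real.sq_sqrt h.le, div_le_iff₀ h, hL, Matrix.add_mul, trace_add,
      trace_conjTranspose_mul_mul hρ.1 (M.posSemidef ξ).1, Complex.add_re, Complex.star_def,
      Complex.conj_re]
    linarith [sq_trace_re_le hρ (M.posSemidef ξ) (L α)]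
  · simpa using h0

lemma hasSum_trace_re (M : POVM ι) (A : Matrix ι ι ℂ) :
    HasSum (fun ξ => 4 * (A * M.elt ξ).trace.re) (4 * A.trace.re) :=
  (Complex.hasSum_re (M.hasSum_trace A)).mul_left 4

lemma summable_sq_score (hρ : (ρ θ).PosSemidef)
    (hL : ∀ α, pderiv ρ θ α = L α * ρ θ + ρ θ * (L α)ᴴ) (M : POVM ι) (α : Fin p) :
    Summable fun ξ => score ρ θ M α ξ ^ 2 :=
  .of_nonneg_of_le (fun _ => sq_nonneg _) (sq_score_le hρ hL M α)
    (hasSum_trace_re M (L α * ρ θ * (L α)ᴴ)).summable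

lemma fisherInfo_diag_le (hρ : (ρ θ).PosSemidef)
    (hL : ∀ α, pderiv ρ θ α = L α * ρ θ + ρ θ * (L α)ᴴ) (M : POVM ι) (α : Fin p) :
    fisherInfo ρ θ M α α ≤ 4 * (L α * ρ θ * (L α)ᴴ).trace.re := by
  rw [fisherInfo_apply, ← (hasSum_trace_re M (L α * ρ θ * (L α)ᴴ)).tsum_eq]
  simp only [← sq]
  exact (summable_sq_score hρ hL M α).tsum_le_tsum (sq_score_le hρ hL M α)
    (hasSum_trace_re M (L α * ρ θ * (L α)ᴴ)).summable

lemma fisherInfo_posSemidef (hρ : (ρ θ).PosSemidef)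
    (hL : ∀ α, pderiv ρ θ α = L α * ρ θ + ρ θ * (L α)ᴴ) (M : POVM ι) :
    (fisherInfo ρ θ M).PosSemidef := by
  have hs (α β) : Summable fun ξ => score ρ θ M α ξ * score ρ θ M β ξ := by
    refine .of_norm_bounded
      (g := fun ξ => (1 / 2) * (score ρ θ M α ξ ^ 2 + score ρ θ M β ξ ^ 2))
      (((summable_sq_score hρ hL M α).add (summable_sq_score hρ hL M β)).mul_left _) fun ξ => ?_
    rw [Real.norm_eq_abs, abs_mul]
    nlinarith [sq_nonneg (|score ρ θ M α ξ| - |score ρ θ M β ξ|),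
      sq_abs (score ρ θ M α ξ), sq_abs (score ρ θ M β ξ)]
  refine .of_dotProduct_mulVec_nonneg ?_ fun x => ?_
  · ext α β
    simp only [conjTranspose_apply, fisherInfo_apply, star_trivial, mul_comm]
  · have h : star x ⬝ᵥ (fisherInfo ρ θ M *ᵥ x) = ∑' ξ, (∑ α, x α * score ρ θ M α ξ) ^ 2 := by
      simp only [dotProduct, mulVec, fisherInfo_apply, Pi.star_apply, star_trivial,
        Finset.mul_sum, sq, Finset.sum_mul]
      rw [Summable.tsum_finsetSum fun α _ => summable_sum fun β _ => ?_]
      · refine Finset.sum_congr rfl fun α _ => ?_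
        rw [Summable.tsum_finsetSum fun β _ => ?_]
        · refine Finset.sum_congr rfl fun β _ => ?_
          rw [← tsum_mul_right, ← tsum_mul_left]
          exact tsum_congr fun ξ => by ring
        · exact ((hs β α).mul_left (x β * x α)).congr fun ξ => by ring
      · exact ((hs β α).mul_left (x β * x α)).congr fun ξ => by ring
    rw [h]
    exact tsum_nonneg fun _ => sq_nonneg _

end Fisher

/-- The inequality between the arithmetic and the harmonic mean of the eigenvalues of `I`, derived
from `tr ((1 - c I) I⁻¹ (1 - c I)) ≥ 0` for the optimal `c = p / t`. -/
lemma le_traceInv {p : ℕ} {I : Matrix (Fin p) (Fin p) ℝ} (hI : I.PosSemidef) {t : ℝ} (ht : 0 < t)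
    (hIt : I.trace ≤ t) : ENNReal.ofReal (p ^ 2 / t) ≤ traceInv I := by
  rw [traceInv]
  split_ifs with hu
  · refine ENNReal.ofReal_le_ofReal ?_
    have h := (hI.inv.mul_mul_conjTranspose_same (1 - ((p : ℝ) / t) • I)).trace_nonneg
    have h1 : (1 - ((p : ℝ) / t) • I) * I⁻¹ * (1 - ((p : ℝ) / t) • I)ᴴ =
        I⁻¹ - (2 * ((p : ℝ) / t)) • 1 + (((p : ℝ) / t) ^ 2) • I := by
      simp only [conjTranspose_sub, conjTranspose_smul, conjTranspose_one, hI.1.eq,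
        Matrix.sub_mul, Matrix.mul_sub, Matrix.smul_mul, Matrix.mul_smul, Matrix.one_mul,
        Matrix.mul_one, mul_nonsing_inv I hu, nonsing_inv_mul I hu, star_trivial]
      module
    rw [h1] at h
    simp only [trace_add, trace_sub, trace_smul, trace_one, Fintype.card_fin, smul_eq_mul] at h
    have h2 : ((p : ℝ) / t) ^ 2 * I.trace ≤ ((p : ℝ) / t) ^ 2 * t := by gcongr
    have h3 : 2 * ((p : ℝ) / t) * p - ((p : ℝ) / t) ^ 2 * t = p ^ 2 / t := by field_simp; ring
    linarith
  · exact le_top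

/-! ### A measurement attaining the bound in a pure state -/

section Attain

variable {ι : Type}

variable [Fintype ι]

lemma ketbra_posSemidef (v : ι → ℂ) : (ketbra v).PosSemidef := posSemidef_vecMulVec_self_star v

variable [DecidableEq ι]

/-- The measurement in an orthonormal family `b`, completed by the projector onto the orthogonal
complement of its span. The outcomes `ξ < q` are the members of `b`, the outcome `q` is the
complement, and the other elements vanish. -/
noncomputable def familyPOVM {q : ℕ} (b : Fin q → ι → ℂ)
    (hb : ∀ j k, star (b j) ⬝ᵥ b k = if j = k then 1 else 0) : POVM ι where
  elt ξ := if h : ξ < q then ketbra (b ⟨ξ, h⟩) else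
    if ξ = q then 1 - ∑ k, ketbra (b k) else 0
  posSemidef ξ := by
    split_ifs
    · exact ketbra_posSemidef _
    · have h1 : (1 - ∑ k, ketbra (b k))ᴴ = 1 - ∑ k, ketbra (b k) := by
        simp [conjTranspose_sum, ketbra, conjTranspose_vecMulVec]
      have h2 : (∑ k, ketbra (b k)) * ∑ k, ketbra (b k) = ∑ k, ketbra (b k) := by
        simp only [ketbra, Finset.sum_mul, Finset.mul_sum, vecMulVec_mul_vecMulVec, hb]
        simp [apply_ite (vecMulVec _)]
      have h3 : (1 - ∑ k, ketbra (b k))ᴴ * (1 - ∑ k, ketbra (b k)) = 1 - ∑ k, ketbra (b k) := by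
        rw [h1, Matrix.sub_mul, Matrix.mul_sub, Matrix.mul_sub, h2]
        simp
      rw [← h3]
      exact posSemidef_conjTranspose_mul_self _
    · exact .zero
  hasSum_one x y := by
    have h (ξ) (hξ : ξ ∉ Finset.range (q + 1)) : (if h : ξ < q then ketbra (b ⟨ξ, h⟩) else
        if ξ = q then 1 - ∑ k, ketbra (b k) else 0) x y = 0 := by
      have h : q < ξ := by rw [Finset.mem_range] at hξ; omega
      rw [dif_neg h.not_gt, if_neg h.ne', Matrix.zero_apply]
    convert! (hasSum_sum_of_ne_finset_zero h : HasSum _ _ (.unconditional ℕ)) using 1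
    rw [Finset.sum_range_succ, Finset.sum_range]
    simp [Matrix.sum_apply]

/-- If the vectors `Ψ` and `Dα = Lα Ψ` of a pure state model with `∂αρ = Lα ρ + ρ Lαᴴ` are pairwise
orthogonal, with all `Dα` of norm `√κ`, then some measurement has Fisher information `4 κ 𝟙`.
The measurement is in an orthonormal basis of the real span of the normalized vectors in which `Ψ`
has no zero coordinate. -/
lemma exists_fisherInfo_eq {p : ℕ} {ρ : (Fin p → ℝ) → Matrix ι ι ℂ} {θ : Fin p → ℝ}
    {L : Fin p → Matrix ι ι ℂ} {Ψ : ι → ℂ} {κ : ℝ} (hp : p ≠ 1) (hκ : 0 < κ)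
    (hρ : ρ θ = ketbra Ψ) (hL : ∀ α, pderiv ρ θ α = L α * ρ θ + ρ θ * (L α)ᴴ)
    (h1 : (ketbra Ψ).trace = 1) (h0 : ∀ α, (L α * ketbra Ψ).trace = 0)
    (h2 : ∀ α β, (L α * ketbra Ψ * (L β)ᴴ).trace = if α = β then (κ : ℂ) else 0) :
    ∃ M : POVM ι, fisherInfo ρ θ M = (4 * κ) • 1 := by

  have hs : (Real.sqrt κ : ℂ) ≠ 0 := by exact_mod_cast (Real.sqrt_pos.mpr hκ).ne'
  have hss : (Real.sqrt κ : ℂ) * Real.sqrt κ = κ := by exact_mod_cast Real.mul_self_sqrt hκ.le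
  have e1 (A : Matrix ι ι ℂ) : (A * ketbra Ψ).trace = star Ψ ⬝ᵥ (A *ᵥ Ψ) := by
    rw [ketbra, mul_vecMulVec, trace_vecMulVec, dotProduct_comm]
  have e2 (A B : Matrix ι ι ℂ) :
      (A * ketbra Ψ * Bᴴ).trace = star (B *ᵥ Ψ) ⬝ᵥ (A *ᵥ Ψ) := by
    rw [ketbra, mul_vecMulVec, vecMulVec_mul, trace_vecMulVec, dotProduct_comm, star_mulVec]
  let f : Fin (p + 1) → ι → ℂ := Fin.cons Ψ fun α => (1 / (Real.sqrt κ : ℂ)) • (L α *ᵥ Ψ)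
  have hf (j k) : star (f j) ⬝ᵥ f k = if j = k then 1 else 0 := by
    refine Fin.cases ?_ (fun α => ?_) j <;> refine Fin.cases ?_ (fun β => ?_) k
    · simpa [f] using (e1 1).symm.trans (by simpa using h1)
    · simp [f, ← e1, h0, (Fin.succ_ne_zero _).symm]
    · have : star (L α *ᵥ Ψ) ⬝ᵥ Ψ = 0 := by
        rw [dotProduct_comm, ← star_star (Ψ ⬝ᵥ _), ← star_dotProduct_star, star_star,
          dotProduct_comm, ← e1, h0, star_zero]
      simp [f, this]
    · simp only [f, Fin.cons_succ, star_smul, smul_dotProduct, dotProduct_smul, ← e2, h2,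
        Fin.succ_inj, eq_comm (a := α)]
      split_ifs
      · simp only [smul_eq_mul, Complex.star_def, map_div₀, map_one, Complex.conj_ofReal, ← hss]
        field_simp
      · simp
  -- the reflection `𝟙 - (2 / (p + 1)) J`, `J` the all ones matrix, is orthogonal, and its first
  -- column has no zero because `p + 1 ≠ 2`
  let o (k j : Fin (p + 1)) : ℝ := (if k = j then 1 else 0) - 2 / (p + 1)
  have ho (j k) : ∑ l, o l j * o l k = if j = k then 1 else 0 := by
    simp only [o, sub_mul, mul_sub, Finset.sum_sub_distrib]
    simp only [ite_mul, one_mul, zero_mul, mul_ite, mul_one, mul_zero, Finset.sum_ite_eq',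
      Finset.mem_univ, if_true, Finset.sum_const, Finset.card_univ, Fintype.card_fin, nsmul_eq_mul,
      eq_comm (a := k)]
    push_cast
    field_simp
    ring
  have ho0 (k) : o k 0 ≠ 0 := by
    simp only [o]
    have : (p : ℝ) ≠ 1 := by exact_mod_cast hp
    split_ifs
    · rw [sub_ne_zero, ne_eq, eq_div_iff (by positivity)]
      intro h; exact this (by linarith)
    · simp; positivity
  let b (k : Fin (p + 1)) : ι → ℂ := ∑ j, (o k j : ℂ) • f j
  have hbf (k j) : star (b k) ⬝ᵥ f j = o k j := by
    simp [b, sum_dotProduct, star_sum, hf]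
  have hfb (k j) : star (f j) ⬝ᵥ b k = o k j := by
    simp [b, dotProduct_sum, hf]
  have ho' (j k) : o j k = o k j := by simp only [o, eq_comm]
  have hb (j k) : star (b j) ⬝ᵥ b k = if j = k then 1 else 0 := by
    have : star (b j) ⬝ᵥ b k = ((∑ l, o l j * o l k : ℝ) : ℂ) := by
      conv_lhs => rw [show b k = ∑ l, (o k l : ℂ) • f l from rfl]
      simp [dotProduct_sum, hbf, ho' _ j, ho' _ k, mul_comm]
    rw [this, ho]
    split_ifs <;> simp
  refine ⟨familyPOVM b hb, ?_⟩
  have hΨ : Ψ = f 0 := rfl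
  have hD (α) : L α *ᵥ Ψ = (Real.sqrt κ : ℂ) • f α.succ := by
    simp [f, smul_smul, hs]
  have hp1 (k) : (ketbra Ψ * ketbra (b k)).trace = ((o k 0 ^ 2 : ℝ) : ℂ) := by
    rw [ketbra, ketbra, vecMulVec_mul_vecMulVec, trace_vecMulVec, dotProduct_smul,
      dotProduct_comm Ψ, hΨ, hbf, hfb]
    simp [sq]
  have hp2 (k α) : (pderiv ρ θ α * ketbra (b k)).trace.re =
      2 * (Real.sqrt κ * o k 0 * o k α.succ) := by
    have : (L α * ketbra Ψ * ketbra (b k)).trace =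
        ((Real.sqrt κ * o k 0 * o k α.succ : ℝ) : ℂ) := by
      rw [ketbra, ketbra, mul_vecMulVec _ Ψ, vecMulVec_mul_vecMulVec, trace_vecMulVec,
        dotProduct_smul, dotProduct_comm (L α *ᵥ Ψ), hD, dotProduct_smul, hΨ, hbf, hfb]
      push_cast
      simp only [smul_eq_mul]
      ring
    rw [hL, hρ, Matrix.add_mul, trace_add, trace_conjTranspose_mul_mul
      (ketbra_posSemidef Ψ).1 (ketbra_posSemidef (b k)).1, this, Complex.star_def,
      Complex.conj_ofReal, Complex.add_re, Complex.ofReal_re]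
    ring
  have hlast : (ketbra Ψ * (1 - ∑ k, ketbra (b k))).trace = 0 := by
    have := ho 0 0
    rw [if_pos rfl] at this
    rw [Matrix.mul_sub, Matrix.mul_one, trace_sub, h1, Finset.mul_sum, trace_sum]
    simp only [hp1, ← Complex.ofReal_sum, sq, this]
    simp
  ext α β
  rw [fisherInfo, of_apply, tsum_eq_sum (s := Finset.range (p + 2)), Finset.sum_range_succ,
    Finset.sum_range]
  · have hk (k : Fin (p + 1)) : (familyPOVM b hb).elt k = ketbra (b k) := dif_pos k.2
    have hl : (familyPOVM b hb).elt (p + 1) = 1 - ∑ k, ketbra (b k) := by simp [familyPOVM]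
    simp only [hk, hl, hρ, hlast, hp1, hp2, Complex.ofReal_re, Complex.zero_re, lt_irrefl, if_false,
      add_zero, sq_pos_of_ne_zero (ho0 _), if_true]
    have h (k : Fin (p + 1)) : 2 * (Real.sqrt κ * o k 0 * o k α.succ) *
        (2 * (Real.sqrt κ * o k 0 * o k β.succ)) / o k 0 ^ 2 =
        4 * κ * (o k α.succ * o k β.succ) := by
      have := ho0 k
      field_simp
      rw [Real.sq_sqrt hκ.le]
      ring
    simp only [h, ← Finset.mul_sum, ho, Fin.succ_inj, Matrix.smul_apply, one_apply, smul_eq_mul]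
  · intro ξ hξ
    have h : p + 1 < ξ := by rw [Finset.mem_range] at hξ; omega
    have : (familyPOVM b hb).elt ξ = 0 := by
      rw [familyPOVM]; exact (dif_neg h.not_gt).trans (if_neg h.ne')
    simp [this]

end Attain

/-! ### Derivatives of matrix curves and of the output model -/

section Deriv

variable {ι : Type}

/-- The curve `B` of matrices has entrywise derivative `B'` at `0`. -/
def HasEntryDeriv (B : ℝ → Matrix ι ι ℂ) (B' : Matrix ι ι ℂ) : Prop :=
  ∀ a b, HasDerivAt (fun t => B t a b) (B' a b) 0

lemma HasEntryDeriv.unique {B : ℝ → Matrix ι ι ℂ} {B' B'' : Matrix ι ι ℂ}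
    (h : HasEntryDeriv B B') (h' : HasEntryDeriv B B'') : B' = B'' := by
  ext a b
  exact (h a b).unique (h' a b)

lemma HasEntryDeriv.pderiv_eq {p : ℕ} {A : (Fin p → ℝ) → Matrix ι ι ℂ} {θ : Fin p → ℝ}
    {α : Fin p} {A' : Matrix ι ι ℂ}
    (h : HasEntryDeriv (fun t => A (θ + t • Pi.single α 1)) A') : pderiv A θ α = A' := by
  ext a b
  exact HasDerivAt.deriv (h a b)

lemma hasEntryDeriv_const (B : Matrix ι ι ℂ) : HasEntryDeriv (fun _ => B) 0 :=
  fun _ _ => hasDerivAt_const _ _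

lemma HasEntryDeriv.conjTranspose {B : ℝ → Matrix ι ι ℂ} {B' : Matrix ι ι ℂ}
    (h : HasEntryDeriv B B') : HasEntryDeriv (fun t => (B t)ᴴ) B'ᴴ :=
  fun a b => (h b a).star

lemma HasEntryDeriv.tensorPow {B : ℝ → Matrix ι ι ℂ} {B' : Matrix ι ι ℂ}
    (h : HasEntryDeriv B B') (N : ℕ) :
    HasEntryDeriv (fun t => tensorPow N (B t)) (tensorDer N (B 0) B') := by
  intro x y
  have := HasDerivAt.fun_finsetProd (u := Finset.univ) fun k _ => h (x k) (y k)
  convert! this using 1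
  simp only [tensorDer, Matrix.sum_apply, tensorProd_update_apply, smul_eq_mul, mul_comm]

lemma HasEntryDeriv.one_kronecker {B : ℝ → Matrix ι ι ℂ} {B' : Matrix ι ι ℂ}
    (h : HasEntryDeriv B B') (dA : ℕ) :
    HasEntryDeriv (fun t => (1 : Matrix (Fin dA) (Fin dA) ℂ) ⊗ₖ B t) (1 ⊗ₖ B') :=
  fun a b => (h a.2 b.2).const_mul _

variable [Fintype ι]

lemma HasEntryDeriv.mul {B C : ℝ → Matrix ι ι ℂ} {B' C' : Matrix ι ι ℂ}
    (hB : HasEntryDeriv B B') (hC : HasEntryDeriv C C') :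
    HasEntryDeriv (fun t => B t * C t) (B' * C 0 + B 0 * C') := by
  intro a b
  have := HasDerivAt.fun_sum (u := Finset.univ) fun k _ => (hB a k).mul (hC k b)
  simpa [mul_apply, Finset.sum_add_distrib] using this

variable [DecidableEq ι]

/-- If `∂B = X B`, then the derivative of `B ω Bᴴ` is the same expression in `B ω Bᴴ` alone. -/
lemma HasEntryDeriv.conj {B : ℝ → Matrix ι ι ℂ} {X : Matrix ι ι ℂ}
    (h : HasEntryDeriv B (X * B 0)) (ω : Matrix ι ι ℂ) :
    HasEntryDeriv (fun t => B t * ω * (B t)ᴴ)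
      (X * (B 0 * ω * (B 0)ᴴ) + B 0 * ω * (B 0)ᴴ * Xᴴ) := by
  have := (h.mul (hasEntryDeriv_const ω)).mul h.conjTranspose
  simpa [Matrix.mul_assoc] using this

lemma HasEntryDeriv.tensorPow_left {B : ℝ → Matrix ι ι ℂ} {X : Matrix ι ι ℂ}
    (h : HasEntryDeriv B (X * B 0)) (N : ℕ) :
    HasEntryDeriv (fun t => SUEstimation.tensorPow N (B t))
      (tensorSum N X * SUEstimation.tensorPow N (B 0)) := by
  rw [← tensorDer_mul_left]
  exact h.tensorPow N

lemma HasEntryDeriv.tensorPow_add {B : ℝ → Matrix ι ι ℂ} {X : Matrix ι ι ℂ}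
    (h : HasEntryDeriv B (X * B 0 + B 0 * Xᴴ)) (N : ℕ) :
    HasEntryDeriv (fun t => SUEstimation.tensorPow N (B t))
      (tensorSum N X * SUEstimation.tensorPow N (B 0) +
        SUEstimation.tensorPow N (B 0) * (tensorSum N X)ᴴ) := by
  rw [conjTranspose_tensorSum, ← tensorDer_mul_left, ← tensorDer_mul_right, ← tensorDer_add]
  exact h.tensorPow N

/-- A curve of determinant one through the identity has a traceless derivative. -/
lemma HasEntryDeriv.trace_eq_zero {B : ℝ → Matrix ι ι ℂ} {X : Matrix ι ι ℂ}
    (h : HasEntryDeriv B X) (h0 : B 0 = 1) (hdet : ∀ t, (B t).det = 1) : X.trace = 0 := by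
  have h1 : HasDerivAt (fun t => (B t).det) (∑ σ : Equiv.Perm ι, (Equiv.Perm.sign σ : ℂ) *
      ∑ i, (∏ j ∈ Finset.univ.erase i, B 0 (σ j) j) • X (σ i) i) 0 := by
    simp only [det_apply']
    exact HasDerivAt.fun_sum fun σ _ =>
      (HasDerivAt.fun_finsetProd fun k _ => h (σ k) k).const_mul _
  simp only [hdet] at h1
  have h2 := h1.unique (hasDerivAt_const _ _)
  rw [← h2, Finset.sum_eq_single 1]
  · simp only [h0, Equiv.Perm.sign_one, Equiv.Perm.one_apply, trace, diag_apply, smul_eq_mul]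
    simp
  · intro σ _ hσ
    rw [Finset.sum_eq_zero, mul_zero]
    intro i _
    -- a permutation that fixes all points but `i` is the identity
    have : ∃ j ∈ Finset.univ.erase i, σ j ≠ j := by
      by_contra! hc
      refine hσ (Equiv.ext fun j => ?_)
      by_cases hj : j = i
      · by_contra hne
        subst hj
        exact hne (σ.injective (hc _ (Finset.mem_erase.mpr ⟨hne, Finset.mem_univ _⟩)))
      · exact hc j (by simp [hj])
    obtain ⟨j, hj, hne⟩ := this
    rw [Finset.prod_eq_zero hj (by rw [h0, one_apply_ne hne]), zero_smul]
  · simp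

end Deriv

section Generators

variable {d : ℕ}

/-- An orthonormal family of `d² - 1` traceless Hermitian matrices, necessarily a basis of the space
of these. -/
structure IsGeneratorBasis (s : Fin (d ^ 2 - 1) → Matrix (Fin d) (Fin d) ℂ) : Prop where
  hermitian : ∀ α, (s α)ᴴ = s α
  trace_eq_zero : ∀ α, (s α).trace = 0
  trace_mul : ∀ α β, (s α * s β).trace = if α = β then 1 else 0

lemma coe_mul_conjTranspose (U : specialUnitaryGroup (Fin d) ℂ) :
    (U : Matrix (Fin d) (Fin d) ℂ) * (U : Matrix (Fin d) (Fin d) ℂ)ᴴ = 1 :=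
  mem_unitaryGroup_iff.mp (mem_specialUnitaryGroup_iff.mp U.2).1

lemma coe_conjTranspose_mul (U : specialUnitaryGroup (Fin d) ℂ) :
    (U : Matrix (Fin d) (Fin d) ℂ)ᴴ * (U : Matrix (Fin d) (Fin d) ℂ) = 1 :=
  mem_unitaryGroup_iff'.mp (mem_specialUnitaryGroup_iff.mp U.2).1

/-- The right-invariant generators `s_α = i ∂_αU U†`: they are unitarily equivalent to the
left-invariant ones `t_α`, and let the output model depend on `U` through the output alone. -/
lemma IsNormalizedAt.exists_generatorBasis
    {U : (Fin (d ^ 2 - 1) → ℝ) → specialUnitaryGroup (Fin d) ℂ} {θ : Fin (d ^ 2 - 1) → ℝ}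
    (h : IsNormalizedAt U θ) : ∃ s : Fin (d ^ 2 - 1) → Matrix (Fin d) (Fin d) ℂ,
      IsGeneratorBasis s ∧ ∀ α, HasEntryDeriv
        (fun t => (U (θ + t • Pi.single α 1) : Matrix (Fin d) (Fin d) ℂ))
        ((-Complex.I • s α) * (U θ : Matrix (Fin d) (Fin d) ℂ)) := by
  set V : Matrix (Fin d) (Fin d) ℂ := (U θ).1 with hV
  set D := fun α => pderiv (fun θ' => (U θ' : Matrix (Fin d) (Fin d) ℂ)) θ α with hD
  have hVV : V * Vᴴ = 1 := coe_mul_conjTranspose _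
  have hVV' : Vᴴ * V = 1 := coe_conjTranspose_mul _
  have hder (α) : HasEntryDeriv
      (fun t : ℝ => (U (θ + t • Pi.single α 1) : Matrix (Fin d) (Fin d) ℂ)) (D α) := fun a b =>
    ((h.differentiableAt a b).lineDifferentiableAt (v := Pi.single α 1)).hasLineDerivAt
  have h0 (α : Fin (d ^ 2 - 1)) : U (θ + (0 : ℝ) • Pi.single α 1) = U θ := by simp
  refine ⟨fun α => Complex.I • (D α * Vᴴ), ⟨fun α => ?_, fun α => ?_, fun α β => ?_⟩, fun α => ?_⟩
  · have h1 := (hder α).mul (hder α).conjTranspose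
    simp only [coe_mul_conjTranspose, h0] at h1
    have h2 := h1.unique (hasEntryDeriv_const 1)
    rw [conjTranspose_smul, conjTranspose_mul, conjTranspose_conjTranspose,
      eq_neg_of_add_eq_zero_left h2]
    simp [hV]
  · have h1 := (hder α).mul (hasEntryDeriv_const Vᴴ)
    rw [Matrix.mul_zero, add_zero] at h1
    rw [trace_smul, h1.trace_eq_zero (by simp [hVV, ← hV]), smul_zero]
    intro t
    rw [hV, det_mul, det_conjTranspose, (mem_specialUnitaryGroup_iff.mp (U θ).2).2,
      (mem_specialUnitaryGroup_iff.mp (U _).2).2]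
    simp
  · rw [← h.trace_mul α β]
    simp only [generator, ← hV]
    have hc : (D α * Vᴴ * (D β * Vᴴ)).trace = (Vᴴ * D α * (Vᴴ * D β)).trace := by
      rw [← Matrix.mul_assoc, trace_mul_comm]
      simp only [Matrix.mul_assoc]
    rw [Matrix.smul_mul, Matrix.mul_smul, Matrix.smul_mul, Matrix.mul_smul, trace_smul, trace_smul,
      trace_smul, trace_smul, hc]
  · convert hder α using 1
    rw [smul_smul, Matrix.smul_mul, Matrix.mul_assoc, hVV']
    simp

/-- The completeness relation `∑ s_α ⊗ s_α = W - 𝟙 / d`: with `𝟙 / √d` the `s_α` form an orthonormal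
basis of all matrices. -/
lemma IsGeneratorBasis.completeness {s : Fin (d ^ 2 - 1) → Matrix (Fin d) (Fin d) ℂ}
    (hs : IsGeneratorBasis s) (hd : 1 ≤ d) (a b c e : Fin d) :
    ∑ α, s α a b * s α c e =
      (if a = e ∧ b = c then 1 else 0) - (if a = b ∧ c = e then 1 else 0) / d := by
  have hd0 : (d : ℂ) ≠ 0 := by exact_mod_cast (by omega : d ≠ 0)
  have hsq : ((Real.sqrt d : ℝ) : ℂ) * (Real.sqrt d : ℝ) = d := by
    exact_mod_cast Real.mul_self_sqrt (Nat.cast_nonneg d)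
  have hsq0 : ((Real.sqrt d : ℝ) : ℂ) ≠ 0 := fun h => hd0 (by rw [← hsq, h, zero_mul])
  let f : Option (Fin (d ^ 2 - 1)) → Matrix (Fin d) (Fin d) ℂ :=
    fun o => o.elim ((1 / ((Real.sqrt d : ℝ) : ℂ)) • 1) s
  have hf (o) : (f o)ᴴ = f o := by
    cases o
    · simp [f]
    · exact hs.hermitian _
  have hff (o o') : (f o * f o').trace = if o = o' then 1 else 0 := by
    cases o <;> cases o'
    · simp [f]
      rw [← mul_assoc, ← mul_inv, hsq, inv_mul_cancel₀ hd0]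
    · simp [f, hs.trace_eq_zero]
    · simp [f, hs.trace_eq_zero]
    · simp [f, hs.trace_mul]
  let B : Matrix (Option (Fin (d ^ 2 - 1))) (Fin d × Fin d) ℂ := of fun o x => f o x.1 x.2
  have hB : B * Bᴴ = 1 := by
    ext o o'
    rw [one_apply, ← hff o o', ← hf o']
    simp [B, mul_apply, trace, Fintype.sum_prod_type]
  have hcard : Fintype.card (Option (Fin (d ^ 2 - 1))) = Fintype.card (Fin d × Fin d) := by
    have : 1 ≤ d ^ 2 := Nat.one_le_pow _ _ hd
    simp only [Fintype.card_option, Fintype.card_fin, Fintype.card_prod]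
    rw [Nat.sub_add_cancel this, sq]
  have h := congrFun (congrFun ((mul_eq_one_comm_of_card_eq _ _ _ hcard).mp hB) (b, a)) (c, e)
  have hc (o) : star (f o b a) = f o a b := by
    conv_rhs => rw [← hf o]
    rfl
  simp only [mul_apply, conjTranspose_apply, B, of_apply, hc, Fintype.sum_option] at h
  have h2 : f none a b * f none c e = (if a = b ∧ c = e then 1 else 0) / d := by
    simp only [f, Option.elim, Matrix.smul_apply, one_apply, smul_eq_mul, ← hsq]
    by_cases h1 : a = b <;> by_cases h2 : c = e <;> simp [h1, h2]
  rw [h2] at h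
  rw [eq_sub_iff_add_eq']
  convert! h using 1
  simp only [one_apply, Prod.mk.injEq, and_comm, eq_comm (a := b)]

end Generators

/-! ### The Casimir operator of the collective generators -/

section Casimir

variable {d n : ℕ}

/-- The operator that swaps the tensor factors `i` and `j`. -/
def factorSwap (d : ℕ) {n : ℕ} (i j : Fin n) : Matrix (Fin n → Fin d) (Fin n → Fin d) ℂ :=
  Matrix.of fun x y => if x = y ∘ Equiv.swap i j then 1 else 0

lemma eq_comp_swap_comm (i j : Fin n) (x y : Fin n → Fin d) :
    x = y ∘ Equiv.swap i j ↔ y = x ∘ Equiv.swap i j := by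
  constructor <;> rintro rfl <;> ext k <;> simp

lemma conjTranspose_factorSwap (i j : Fin n) : (factorSwap d i j)ᴴ = factorSwap d i j := by
  ext x y
  simp only [factorSwap, conjTranspose_apply, of_apply, eq_comp_swap_comm i j y x]
  split_ifs <;> simp

lemma factorSwap_mul_self (i j : Fin n) : factorSwap d i j * factorSwap d i j = 1 := by
  ext x y
  simp only [factorSwap, mul_apply, of_apply, one_apply, mul_ite, mul_one, mul_zero,
    Finset.sum_ite_eq', Finset.mem_univ, if_true, Function.comp_assoc]
  congr 1
  simp [funext_iff]

lemma eq_comp_swap_iff {i j : Fin n} (hij : i ≠ j) (x y : Fin n → Fin d) :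
    x = y ∘ Equiv.swap i j ↔
      (x j = y i ∧ x i = y j) ∧ ∀ k ∈ (Finset.univ.erase j).erase i, x k = y k := by
  constructor
  · rintro rfl
    refine ⟨by simp, fun k hk => ?_⟩
    simp only [Finset.mem_erase, Finset.mem_univ, and_true] at hk
    simp [Equiv.swap_apply_of_ne_of_ne hk.1 hk.2]
  · rintro ⟨⟨h1, h2⟩, h⟩
    ext1 k
    by_cases hi : k = i
    · subst hi; simpa using h2
    by_cases hj : k = j
    · subst hj; simpa using h1
    rw [Function.comp_apply, Equiv.swap_apply_of_ne_of_ne hi hj]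
    exact h k (by simp [hi, hj])

lemma eq_iff_of_ne {i j : Fin n} (x y : Fin n → Fin d) :
    x = y ↔ (x j = y j ∧ x i = y i) ∧ ∀ k ∈ (Finset.univ.erase j).erase i, x k = y k := by
  constructor
  · rintro rfl; simp
  · rintro ⟨⟨h1, h2⟩, h⟩
    ext1 k
    by_cases hi : k = i
    · subst hi; exact h2
    by_cases hj : k = j
    · subst hj; exact h1
    exact h k (by simp [hi, hj])

variable {s : Fin (d ^ 2 - 1) → Matrix (Fin d) (Fin d) ℂ}

lemma IsGeneratorBasis.sum_sq (hs : IsGeneratorBasis s) (hd : 1 ≤ d) :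
    ∑ α, s α * s α = ((d : ℂ) - 1 / d) • 1 := by
  ext a e
  simp only [Matrix.sum_apply, mul_apply, Matrix.smul_apply, one_apply, smul_eq_mul]
  rw [Finset.sum_comm]
  simp only [hs.completeness hd, and_true, Finset.sum_sub_distrib, ← Finset.sum_div]
  by_cases h : a = e
  · subst h
    have : ∀ x : Fin d, (a = x ∧ x = a) ↔ x = a := fun x => ⟨fun h => h.2, fun h => ⟨h.symm, h⟩⟩
    simp [this]
  · have : ∀ x : Fin d, ¬ (a = x ∧ x = e) := fun x hx => h (hx.1.trans hx.2)
    simp [h, this]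

lemma IsGeneratorBasis.sum_site_mul_site (hs : IsGeneratorBasis s) (hd : 1 ≤ d) (i j : Fin n) :
    ∑ α, tensorProd (Function.update (fun _ => 1) i (s α)) *
        tensorProd (Function.update (fun _ => 1) j (s α)) =
      if i = j then ((d : ℂ) - 1 / d) • 1 else factorSwap d i j - (1 / d : ℂ) • 1 := by
  split_ifs with hij
  · subst hij
    have h (α) : tensorProd (Function.update (fun _ => 1) i (s α)) *
        tensorProd (Function.update (fun _ => 1) i (s α)) =
        tensorProd (Function.update (fun _ => 1) i (s α * s α)) := by
      rw [tensorProd_mul]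
      refine congrArg _ (funext fun k => ?_)
      by_cases h : k = i
      · subst h; simp
      · simp [h]
    ext x y
    simp only [h, Matrix.sum_apply, tensorProd_update_apply, ← Finset.sum_mul]
    rw [← Matrix.sum_apply, hs.sum_sq hd, Matrix.smul_apply, Matrix.smul_apply, ← tensorPow_one,
      tensorPow, of_apply, ← Finset.mul_prod_erase _ _ (Finset.mem_univ i), smul_eq_mul,
      smul_eq_mul, mul_assoc]
  · have h (α) : tensorProd (Function.update (fun _ => 1) i (s α)) *
        tensorProd (Function.update (fun _ => 1) j (s α)) =
        tensorProd (Function.update (Function.update (fun _ => 1) i (s α)) j (s α)) := by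
      rw [tensorProd_mul]
      refine congrArg _ (funext fun k => ?_)
      by_cases h : k = j
      · subst h; simp [Ne.symm hij]
      · simp [h]
    have hi : i ∈ Finset.univ.erase j := by simp [hij]
    have h' (α) (x y : Fin n → Fin d) : ∏ k ∈ Finset.univ.erase j,
        Function.update (fun _ => (1 : Matrix (Fin d) (Fin d) ℂ)) i (s α) k (x k) (y k) =
        s α (x i) (y i) * if ∀ k ∈ (Finset.univ.erase j).erase i, x k = y k then 1 else 0 := by
      have h1 : ∏ k ∈ (Finset.univ.erase j).erase i,
          Function.update (fun _ => (1 : Matrix (Fin d) (Fin d) ℂ)) i (s α) k (x k) (y k) =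
          ∏ k ∈ (Finset.univ.erase j).erase i, if x k = y k then 1 else 0 :=
        Finset.prod_congr rfl fun k hk => by
          rw [Function.update_of_ne (Finset.ne_of_mem_erase hk), one_apply]
      rw [← Finset.mul_prod_erase _ _ hi, Function.update_self, h1, Finset.prod_ite_zero,
        Finset.prod_const_one]
      congr!
    ext x y
    simp only [h, Matrix.sum_apply, tensorProd_update_apply, h', ← mul_assoc, ← Finset.sum_mul,
      hs.completeness hd, Matrix.sub_apply, Matrix.smul_apply, one_apply, factorSwap, of_apply,
      eq_comp_swap_iff hij, eq_iff_of_ne (i := i) (j := j) x y, smul_eq_mul,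
      eq_comm (a := y j) (b := x i)]
    by_cases hR : ∀ k ∈ (Finset.univ.erase j).erase i, x k = y k
    · simp only [if_pos hR, and_iff_left hR]
      ring
    · simp only [hR, if_false, and_false, mul_zero, sub_zero]

/-- The quadratic Casimir operator, expressed by the permutations of the tensor factors. -/
lemma IsGeneratorBasis.casimir (hs : IsGeneratorBasis s) (hd : 1 ≤ d) :
    ∑ α, tensorSum n (s α) * tensorSum n (s α) = ∑ i : Fin n, ∑ j : Fin n,
      if i = j then ((d : ℂ) - 1 / d) • (1 : Matrix (Fin n → Fin d) (Fin n → Fin d) ℂ)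
        else factorSwap d i j - (1 / d : ℂ) • 1 := by
  simp only [← hs.sum_site_mul_site hd, tensorSum, tensorDer, Finset.sum_mul, Finset.mul_sum]
  rw [Finset.sum_comm]
  conv_rhs => rw [Finset.sum_comm]
  refine Finset.sum_congr rfl fun i _ => ?_
  rw [Finset.sum_comm]

lemma trace_mul_re_le {ι : Type} [Fintype ι] [DecidableEq ι] {ω P : Matrix ι ι ℂ}
    (hω : ω.PosSemidef) (hP : Pᴴ = P) (hPP : P * P = 1) : (ω * P).trace.re ≤ ω.trace.re := by
  have h := trace_mul_nonneg_re hω (posSemidef_conjTranspose_mul_self (1 - P))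
  have h1 : (1 - P)ᴴ * (1 - P) = (2 : ℂ) • (1 - P) := by
    rw [conjTranspose_sub, conjTranspose_one, hP, Matrix.sub_mul, Matrix.mul_sub, Matrix.mul_sub,
      hPP]
    simp only [Matrix.one_mul, Matrix.mul_one]
    module
  rw [h1, Matrix.mul_smul, trace_smul, Matrix.mul_sub, trace_sub, Matrix.mul_one] at h
  simp at h
  linarith

/-- The Casimir operator is largest on the symmetric subspace, where all permutations act
trivially. -/
lemma IsGeneratorBasis.casimir_le (hs : IsGeneratorBasis s) (hd : 1 ≤ d) {dA : ℕ}
    {ω : Matrix (Idx dA d n) (Idx dA d n) ℂ} (hω : IsDensity ω) :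
    ∑ α, (((1 : Matrix (Fin dA) (Fin dA) ℂ) ⊗ₖ tensorSum n (s α)) * ω *
        ((1 : Matrix (Fin dA) (Fin dA) ℂ) ⊗ₖ tensorSum n (s α))).trace.re ≤
      n * (n + d) * (d - 1) / d := by
  have hd0 : (d : ℝ) ≠ 0 := by exact_mod_cast (by omega : d ≠ 0)
  have h1 (i j : Fin n) : (ω * ((1 : Matrix (Fin dA) (Fin dA) ℂ) ⊗ₖ
      (if i = j then ((d : ℂ) - 1 / d) • (1 : Matrix (Fin n → Fin d) (Fin n → Fin d) ℂ)
        else factorSwap d i j - (1 / d : ℂ) • 1))).trace.re ≤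
      (1 - 1 / d : ℝ) + if i = j then (d - 1 : ℝ) else 0 := by
    have hω1 : (ω * ((1 : Matrix (Fin dA) (Fin dA) ℂ) ⊗ₖ
        (1 : Matrix (Fin n → Fin d) (Fin n → Fin d) ℂ))).trace = 1 := by
      rw [one_kronecker_one, Matrix.mul_one, hω.trace_eq_one]
    split_ifs with hij
    · rw [kronecker_smul, Matrix.mul_smul, trace_smul, hω1]
      simp
    · have hk (A B : Matrix (Fin n → Fin d) (Fin n → Fin d) ℂ) :
          (1 : Matrix (Fin dA) (Fin dA) ℂ) ⊗ₖ (A - B) = 1 ⊗ₖ A - 1 ⊗ₖ B := by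
        ext a b
        simp [mul_sub]
      rw [hk, kronecker_smul, Matrix.mul_sub, Matrix.mul_smul, trace_sub, trace_smul,
        hω1]
      have := trace_mul_re_le hω.posSemidef (P := (1 : Matrix (Fin dA) (Fin dA) ℂ) ⊗ₖ
        factorSwap d i j) (by rw [conjTranspose_kronecker, conjTranspose_factorSwap,
          conjTranspose_one]) (by rw [← mul_kronecker_mul, factorSwap_mul_self, Matrix.mul_one,
          one_kronecker_one])
      rw [hω.trace_eq_one, Complex.one_re] at this
      have h2 : ((1 / d : ℂ) • (1 : ℂ)).re = 1 / d := by
        simp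
      rw [Complex.sub_re, h2]
      linarith
  have h2 : ∑ α, (((1 : Matrix (Fin dA) (Fin dA) ℂ) ⊗ₖ tensorSum n (s α)) * ω *
        ((1 : Matrix (Fin dA) (Fin dA) ℂ) ⊗ₖ tensorSum n (s α))).trace.re =
      ∑ i : Fin n, ∑ j : Fin n, (ω * ((1 : Matrix (Fin dA) (Fin dA) ℂ) ⊗ₖ
      (if i = j then ((d : ℂ) - 1 / d) • (1 : Matrix (Fin n → Fin d) (Fin n → Fin d) ℂ)
        else factorSwap d i j - (1 / d : ℂ) • 1))).trace.re := by
    simp only [← Complex.re_sum, ← trace_sum, ← Finset.mul_sum]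
    have hk {κ : Type} (t : Finset κ) (f : κ → Matrix (Fin n → Fin d) (Fin n → Fin d) ℂ) :
        ∑ k ∈ t, (1 : Matrix (Fin dA) (Fin dA) ℂ) ⊗ₖ f k = 1 ⊗ₖ ∑ k ∈ t, f k := by
      ext a b
      simp [Matrix.sum_apply, Finset.mul_sum]
    simp only [hk, ← hs.casimir hd]
    rw [← hk, Finset.mul_sum, trace_sum, trace_sum]
    congr 1
    refine Finset.sum_congr rfl fun α _ => ?_
    rw [Matrix.mul_assoc, trace_mul_comm, Matrix.mul_assoc, ← mul_kronecker_mul, Matrix.mul_one]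
  rw [h2]
  calc _ ≤ ∑ i : Fin n, ∑ j : Fin n, ((1 - 1 / d : ℝ) + if i = j then (d - 1 : ℝ) else 0) :=
        Finset.sum_le_sum fun i _ => Finset.sum_le_sum fun j _ => h1 i j
    _ = n * (n + d) * (d - 1) / d := by
        simp [Finset.sum_add_distrib]
        field_simp

end Casimir

/-! ### Moments of 2-designs and of the input state -/

section Design

variable {d m n : ℕ}

/-- The second moments of the states `|vᵢ⟩` are those of a 2-design: the defining identity in the
weak form, obtained by taking the trace against `A ⊗ B`. -/
structure HasDesignMoments (v : Fin m → Fin d → ℂ) : Prop where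
  trace_ketbra : ∀ i, (ketbra (v i)).trace = 1
  second : ∀ A B : Matrix (Fin d) (Fin d) ℂ,
    (1 / m : ℂ) * ∑ i, (A * ketbra (v i)).trace * (B * ketbra (v i)).trace =
      (A.trace * B.trace + (A * B).trace) / (d * (d + 1))

lemma IsTwoDesign.hasDesignMoments {τ : Fin m → EuclideanSpace ℂ (Fin d)} (hτ : IsTwoDesign τ) :
    HasDesignMoments fun i => (τ i : Fin d → ℂ) where
  trace_ketbra i := by
    have h := hτ.norm_eq_one i
    rw [EuclideanSpace.norm_eq, Real.sqrt_eq_one] at h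
    rw [ketbra, trace_vecMulVec, dotProduct]
    simp only [Pi.star_apply, Complex.star_def, Complex.mul_conj, Complex.normSq_eq_norm_sq]
    exact_mod_cast h
  second A B := by
    have h := congrArg (fun X => ((A ⊗ₖ B) * X).trace) hτ.average
    have hsw : ((A ⊗ₖ B) * swapMatrix d).trace = (A * B).trace := by
      simp only [trace, mul_apply, diag_apply, swapMatrix, of_apply, kroneckerMap_apply,
        mul_ite, mul_one, mul_zero, Finset.sum_ite_eq', Finset.mem_univ, if_true,
        Fintype.sum_prod_type, Prod.fst_swap, Prod.snd_swap]
    simp only [symProj, Matrix.mul_smul, trace_smul, Finset.mul_sum, trace_sum,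
      ← mul_kronecker_mul, trace_kronecker, Matrix.mul_add, trace_add, Matrix.mul_one, hsw,
      smul_eq_mul] at h
    rw [Finset.mul_sum, h]
    ring

lemma ketbra_mulVec {ι : Type} [Fintype ι] (A : Matrix ι ι ℂ) (v : ι → ℂ) :
    ketbra (A *ᵥ v) = A * ketbra v * Aᴴ := by
  rw [ketbra, ketbra, mul_vecMulVec, vecMulVec_mul, star_mulVec]

lemma HasDesignMoments.mulVec {v : Fin m → Fin d → ℂ} (hv : HasDesignMoments v)
    {U : Matrix (Fin d) (Fin d) ℂ} (hU : Uᴴ * U = 1) :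
    HasDesignMoments fun i => U *ᵥ v i where
  trace_ketbra i := by
    rw [ketbra_mulVec, Matrix.mul_assoc, trace_mul_comm, Matrix.mul_assoc, hU, Matrix.mul_one,
      hv.trace_ketbra]
  second A B := by
    have hU' : U * Uᴴ = 1 := mul_eq_one_comm.mp hU
    have h (A : Matrix (Fin d) (Fin d) ℂ) (i) :
        (A * ketbra (U *ᵥ v i)).trace = (Uᴴ * A * U * ketbra (v i)).trace := by
      rw [ketbra_mulVec, ← Matrix.mul_assoc, trace_mul_comm]
      simp only [Matrix.mul_assoc]
    have h1 (A : Matrix (Fin d) (Fin d) ℂ) : (Uᴴ * A * U).trace = A.trace := by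
      rw [trace_mul_comm, ← Matrix.mul_assoc, hU', Matrix.one_mul]
    have h2 : Uᴴ * A * U * (Uᴴ * B * U) = Uᴴ * (A * B) * U := by
      calc _ = Uᴴ * A * (U * Uᴴ) * B * U := by simp only [Matrix.mul_assoc]
        _ = _ := by rw [hU', Matrix.mul_one, Matrix.mul_assoc Uᴴ A B]
    simp only [h, hv.second, h1, h2]

lemma HasDesignMoments.first {v : Fin m → Fin d → ℂ} (hv : HasDesignMoments v) (hd : 1 ≤ d)
    (A : Matrix (Fin d) (Fin d) ℂ) :
    (1 / m : ℂ) * ∑ i, (A * ketbra (v i)).trace = A.trace / d := by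
  have h := hv.second A 1
  simp only [Matrix.one_mul, hv.trace_ketbra, mul_one, trace_one, Fintype.card_fin] at h
  have hd0 : (d : ℂ) ≠ 0 := by exact_mod_cast (by omega : d ≠ 0)
  have hd1 : (d : ℂ) + 1 ≠ 0 := by exact_mod_cast d.succ_ne_zero
  rw [h]
  field_simp

lemma HasDesignMoments.ne_zero {v : Fin m → Fin d → ℂ} (hv : HasDesignMoments v) (hd : 1 ≤ d) :
    m ≠ 0 := by
  rintro rfl
  have h := hv.first hd 1
  have hd0 : (d : ℂ) ≠ 0 := by exact_mod_cast (by omega : d ≠ 0)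
  simp [hd0] at h

/-- The vector `m^{-1/2} ∑ᵢ |i⟩ ⊗ |vᵢ⟩^{⊗n}`. -/
noncomputable def designVec (n : ℕ) (v : Fin m → Fin d → ℂ) : Idx m d n → ℂ :=
  fun ix => (1 / (Real.sqrt m : ℂ)) * ∏ k, v ix.1 (ix.2 k)

lemma trace_mul_ketbra_designVec (v : Fin m → Fin d → ℂ)
    (P : Matrix (Fin n → Fin d) (Fin n → Fin d) ℂ) :
    (((1 : Matrix (Fin m) (Fin m) ℂ) ⊗ₖ P) * ketbra (designVec n v)).trace =
      (1 / m : ℂ) * ∑ i, (P * tensorPow n (ketbra (v i))).trace := by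
  have hm : ((Real.sqrt m : ℝ) : ℂ) * (Real.sqrt m : ℝ) = m := by
    exact_mod_cast Real.mul_self_sqrt (Nat.cast_nonneg m)
  simp only [tensorPow_ketbra]
  simp only [trace, diag_apply, mul_apply, Fintype.sum_prod_type, kroneckerMap_apply, one_apply,
    ite_mul, one_mul, zero_mul, Finset.mul_sum, ketbra, vecMulVec_apply, designVec, Pi.star_apply]
  refine Finset.sum_congr rfl fun i _ => Finset.sum_congr rfl fun x _ => ?_
  rw [Finset.sum_eq_single i]
  · simp only [if_true]
    refine Finset.sum_congr rfl fun y _ => ?_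
    rw [star_mul', Complex.star_def, map_div₀, map_one, Complex.conj_ofReal, ← hm]
    ring
  · intro j _ hj
    simp [Ne.symm hj]
  · simp

variable {v : Fin m → Fin d → ℂ}

lemma HasDesignMoments.trace_designVec (hv : HasDesignMoments v) (hd : 1 ≤ d) :
    (ketbra (designVec n v)).trace = 1 := by
  have hm : (m : ℂ) ≠ 0 := by exact_mod_cast hv.ne_zero hd
  have h := trace_mul_ketbra_designVec (n := n) v 1
  rw [one_kronecker_one, Matrix.one_mul] at h
  simp [h, trace_tensorPow, hv.trace_ketbra, hm]

lemma HasDesignMoments.trace_tensorSum (hv : HasDesignMoments v) (hd : 1 ≤ d)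
    (X : Matrix (Fin d) (Fin d) ℂ) :
    (((1 : Matrix (Fin m) (Fin m) ℂ) ⊗ₖ tensorSum n X) * ketbra (designVec n v)).trace =
      n * (X.trace / d) := by
  rw [trace_mul_ketbra_designVec, ← hv.first hd]
  simp only [trace_tensorSum_mul (hv.trace_ketbra _), ← Finset.mul_sum]
  ring

lemma HasDesignMoments.trace_tensorSum_tensorSum (hv : HasDesignMoments v) (hd : 1 ≤ d)
    (X Y : Matrix (Fin d) (Fin d) ℂ) :
    (((1 : Matrix (Fin m) (Fin m) ℂ) ⊗ₖ tensorSum n X) * ketbra (designVec n v) *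
      ((1 : Matrix (Fin m) (Fin m) ℂ) ⊗ₖ tensorSum n Y)).trace =
      n * ((X * Y).trace / d) +
        n * (n - 1) * ((X.trace * Y.trace + (X * Y).trace) / (d * (d + 1))) := by
  have h (i) : (tensorSum n Y * tensorSum n X * tensorPow n (ketbra (v i))).trace =
      n * (Y * X * ketbra (v i)).trace +
        n * (n - 1) * ((X * ketbra (v i)).trace * (Y * ketbra (v i)).trace) := by
    rw [Matrix.mul_assoc, trace_mul_comm, trace_tensorSum_mul_mul (hv.trace_ketbra _),
      trace_mul_comm (X * _), ← Matrix.mul_assoc, trace_mul_comm _ Y]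
  rw [trace_mul_comm, ← Matrix.mul_assoc, ← mul_kronecker_mul, Matrix.mul_one,
    trace_mul_ketbra_designVec]
  simp only [h, Finset.sum_add_distrib, ← Finset.mul_sum]
  rw [← hv.second, trace_mul_comm X Y, ← hv.first hd]
  ring

end Design

/-! ### Injectivity up to phases -/

section Injectivity

variable {d m n : ℕ} {τ : Fin m → EuclideanSpace ℂ (Fin d)}

lemma outputVec_eq (U : specialUnitaryGroup (Fin d) ℂ) :
    outputVec n τ U = designVec n fun i => (U : Matrix (Fin d) (Fin d) ℂ) *ᵥ (τ i : Fin d → ℂ) := by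
  ext ix
  simp only [outputVec, gate, inputVec, designVec, mulVec, dotProduct, Fintype.sum_prod_type,
    kroneckerMap_apply, one_apply, ite_mul, one_mul, zero_mul, Finset.prod_univ_sum,
    Fintype.piFinset_univ, Finset.mul_sum]
  rw [Finset.sum_eq_single ix.1]
  · refine Finset.sum_congr rfl fun y _ => ?_
    rw [if_pos rfl, tensorPow, of_apply, Finset.prod_mul_distrib]
    ring
  · intro j _ hj
    simp [Ne.symm hj]
  · simp

lemma outputVec_smul {U₁ U₂ : specialUnitaryGroup (Fin d) ℂ} {ζ : ℂ}
    (h : (U₁ : Matrix (Fin d) (Fin d) ℂ) = ζ • (U₂ : Matrix (Fin d) (Fin d) ℂ)) :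
    outputVec n τ U₁ = ζ ^ n • outputVec n τ U₂ := by
  ext ix
  simp only [outputVec_eq, designVec, h, smul_mulVec, Pi.smul_apply, smul_eq_mul,
    Finset.prod_mul_distrib, Finset.prod_const, Finset.card_univ, Fintype.card_fin]
  ring

lemma outputVec_ne_zero (hτ : IsTwoDesign τ) (hd : 1 ≤ d) (U : specialUnitaryGroup (Fin d) ℂ) :
    outputVec n τ U ≠ 0 := by
  intro h
  have h1 := (hτ.hasDesignMoments.mulVec (coe_conjTranspose_mul U)).trace_designVec (n := n) hd
  rw [← outputVec_eq, h] at h1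
  simp [ketbra] at h1

/-- The tensor power of a unit vector determines its projector: take expectations of collective
operators. -/
lemma ketbra_eq_of_prod_eq {v w : Fin d → ℂ} (hn : 1 ≤ n) (hv : (ketbra v).trace = 1)
    (hw : (ketbra w).trace = 1) {c : ℂ}
    (h : ∀ x : Fin n → Fin d, ∏ k, v (x k) = c * ∏ k, w (x k)) : ketbra v = ketbra w := by
  have h1 : tensorPow n (ketbra v) = (c * star c) • tensorPow n (ketbra w) := by
    ext x y
    rw [tensorPow_ketbra, tensorPow_ketbra]
    simp only [ketbra, vecMulVec_apply, Pi.star_apply, h, Matrix.smul_apply, smul_eq_mul, star_mul']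
    ring
  have h2 : c * star c = 1 := by
    have := congrArg trace h1
    rw [trace_smul, trace_tensorPow, trace_tensorPow, hv, hw] at this
    simpa using this.symm
  rw [h2, one_smul] at h1
  refine ext_iff_trace_mul_left.mpr fun X => ?_
  have h3 := congrArg (fun P => (tensorSum n X * P).trace) h1
  simp only [trace_tensorSum_mul hv, trace_tensorSum_mul hw] at h3
  exact mul_left_cancel₀ (by exact_mod_cast (by omega : n ≠ 0)) h3

/-- A matrix that commutes with all the projectors of a 2-design is a scalar: for such `V` the
second moment of `V` and `Y` is a first moment of `V Y`, so that `tr V tr Y = d tr (V Y)`. -/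
lemma HasDesignMoments.eq_smul_one {v : Fin m → Fin d → ℂ} (hv : HasDesignMoments v) (hd : 1 ≤ d)
    {V : Matrix (Fin d) (Fin d) ℂ} (hV : ∀ i, V * ketbra (v i) = ketbra (v i) * V) :
    V = (V.trace / d) • 1 := by
  have hd0 : (d : ℂ) ≠ 0 := by exact_mod_cast (by omega : d ≠ 0)
  have hd1 : (d : ℂ) + 1 ≠ 0 := by exact_mod_cast d.succ_ne_zero
  refine ext_iff_trace_mul_right.mpr fun Y => ?_
  have h (i) : (V * ketbra (v i)).trace * (Y * ketbra (v i)).trace =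
      (V * Y * ketbra (v i)).trace := by
    have hK : ketbra (v i) * Y * ketbra (v i) = (Y * ketbra (v i)).trace • ketbra (v i) := by
      rw [ketbra, mul_vecMulVec Y, trace_vecMulVec, vecMulVec_mul, vecMulVec_mul_vecMulVec,
        vecMulVec_smul, ← dotProduct_mulVec, dotProduct_comm]
    have hKK : ketbra (v i) * ketbra (v i) = ketbra (v i) := by
      have := hv.trace_ketbra i
      rw [ketbra, trace_vecMulVec, dotProduct_comm] at this
      rw [ketbra, vecMulVec_mul_vecMulVec, this, one_smul]
    calc _ = (V * (ketbra (v i) * Y * ketbra (v i))).trace := by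
          rw [hK, Matrix.mul_smul, trace_smul, smul_eq_mul, mul_comm]
      _ = (ketbra (v i) * (V * Y) * ketbra (v i)).trace := by
          simp only [← Matrix.mul_assoc, hV i]
      _ = _ := by rw [Matrix.mul_assoc, trace_mul_comm, Matrix.mul_assoc, hKK]
  have h2 := hv.second V Y
  simp only [h, hv.first hd] at h2
  rw [Matrix.smul_mul, Matrix.one_mul, trace_smul, smul_eq_mul]
  field_simp at h2 ⊢
  linear_combination h2

lemma exists_eq_smul_of_outputVec (hτ : IsTwoDesign τ) (hd : 1 ≤ d) (hn : 1 ≤ n)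
    {U₁ U₂ : specialUnitaryGroup (Fin d) ℂ} {c : ℂ}
    (h : outputVec n τ U₁ = c • outputVec n τ U₂) :
    ∃ ζ : ℂ, (U₁ : Matrix (Fin d) (Fin d) ℂ) = ζ • (U₂ : Matrix (Fin d) (Fin d) ℂ) := by
  have hv := hτ.hasDesignMoments
  have hm : ((Real.sqrt m : ℝ) : ℂ) ≠ 0 := by
    have := Nat.pos_of_ne_zero (hv.ne_zero hd)
    exact_mod_cast (Real.sqrt_pos.mpr (by exact_mod_cast this)).ne'
  obtain ⟨V₁, hV₁⟩ : ∃ V : Matrix (Fin d) (Fin d) ℂ, V = U₁ := ⟨_, rfl⟩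
  obtain ⟨V₂, hV₂⟩ : ∃ V : Matrix (Fin d) (Fin d) ℂ, V = U₂ := ⟨_, rfl⟩
  have h1 : V₁ᴴ * V₁ = 1 := hV₁ ▸ coe_conjTranspose_mul U₁
  have h2 : V₂ᴴ * V₂ = 1 := hV₂ ▸ coe_conjTranspose_mul U₂
  have h2' : V₂ * V₂ᴴ = 1 := hV₂ ▸ coe_mul_conjTranspose U₂
  rw [outputVec_eq, outputVec_eq, ← hV₁, ← hV₂] at h
  rw [← hV₁, ← hV₂]
  have hK (i) : V₁ * ketbra (τ i) * V₁ᴴ = V₂ * ketbra (τ i) * V₂ᴴ := by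
    rw [← ketbra_mulVec, ← ketbra_mulVec]
    refine ketbra_eq_of_prod_eq (c := c) hn ((hv.mulVec h1).trace_ketbra i)
      ((hv.mulVec h2).trace_ketbra i) fun x => ?_
    have := congrFun h (i, x)
    simp only [designVec, Pi.smul_apply, smul_eq_mul] at this
    refine mul_left_cancel₀ (one_div_ne_zero hm) (this.trans ?_)
    ring
  have hV := hv.eq_smul_one hd (V := V₂ᴴ * V₁) fun i => by
    calc V₂ᴴ * V₁ * ketbra (τ i) = V₂ᴴ * (V₁ * ketbra (τ i) * V₁ᴴ) * V₁ := by
          simp only [Matrix.mul_assoc, h1, Matrix.mul_one]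
      _ = V₂ᴴ * V₂ * ketbra (τ i) * (V₂ᴴ * V₁) := by
          rw [hK]; simp only [Matrix.mul_assoc]
      _ = _ := by rw [h2, Matrix.one_mul]
  refine ⟨(V₂ᴴ * V₁).trace / d, ?_⟩
  calc V₁ = V₂ * (V₂ᴴ * V₁) := by rw [← Matrix.mul_assoc, h2', Matrix.one_mul]
    _ = _ := by rw [hV, Matrix.mul_smul, Matrix.mul_one, ← hV]

lemma outputVec_eq_iff (hτ : IsTwoDesign τ) (hd : 1 ≤ d) (hn : 1 ≤ n)
    (U₁ U₂ : specialUnitaryGroup (Fin d) ℂ) :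
    outputVec n τ U₁ = outputVec n τ U₂ ↔ ∃ ζ : ℂ, ζ ^ n = 1 ∧
      (U₁ : Matrix (Fin d) (Fin d) ℂ) = ζ • (U₂ : Matrix (Fin d) (Fin d) ℂ) := by
  constructor
  · intro h
    obtain ⟨ζ, hζ⟩ := exists_eq_smul_of_outputVec hτ hd hn (U₂ := U₂) (c := 1) (by rw [h, one_smul])
    refine ⟨ζ, ?_, hζ⟩
    rw [outputVec_smul hζ] at h
    exact smul_left_injective ℂ (outputVec_ne_zero (n := n) hτ hd U₂) (by simpa using h)
  · rintro ⟨ζ, h1, hζ⟩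
    rw [outputVec_smul hζ, h1, one_smul]

lemma outputVec_injective_iff (hτ : IsTwoDesign τ) (hd : 1 ≤ d) (hn : 1 ≤ n) :
    Function.Injective (outputVec n τ : specialUnitaryGroup (Fin d) ℂ → Idx m d n → ℂ) ↔
      Nat.Coprime n d := by
  constructor
  · intro h
    -- a primitive root of unity of order `gcd n d`, as a scalar matrix, leaves the input unchanged
    have hg : Nat.gcd n d ≠ 0 := by
      rw [ne_eq, Nat.gcd_eq_zero_iff]; omega
    have hζ := Complex.isPrimitiveRoot_exp _ hg
    set ζ := Complex.exp (2 * Real.pi * Complex.I / (Nat.gcd n d : ℕ))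
    have hn1 : ζ ^ n = 1 := (hζ.pow_eq_one_iff_dvd _).mpr (Nat.gcd_dvd_left n d)
    have hd1 : ζ ^ d = 1 := (hζ.pow_eq_one_iff_dvd _).mpr (Nat.gcd_dvd_right n d)
    have hnorm : ζ * star ζ = 1 := by
      rw [Complex.star_def, Complex.mul_conj, Complex.normSq_eq_norm_sq,
        Complex.norm_eq_one_of_pow_eq_one hd1 (by omega)]
      simp
    have hmem : ζ • (1 : Matrix (Fin d) (Fin d) ℂ) ∈ specialUnitaryGroup (Fin d) ℂ := by
      rw [mem_specialUnitaryGroup_iff, mem_unitaryGroup_iff]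
      refine ⟨?_, by simp [hd1]⟩
      rw [star_smul, star_one, Matrix.smul_mul, Matrix.mul_smul, smul_smul, hnorm]
      simp
    have h1 := h ((outputVec_eq_iff hτ hd hn ⟨_, hmem⟩ 1).mpr ⟨ζ, hn1, rfl⟩)
    have h2 : ζ = 1 := by
      have := congrFun (congrFun (congrArg Subtype.val h1) ⟨0, hd⟩) ⟨0, hd⟩
      simpa using this
    rw [h2] at hζ
    exact hζ.unique IsPrimitiveRoot.one
  · intro hc U₁ U₂ h
    obtain ⟨ζ, hζ, hU⟩ := (outputVec_eq_iff hτ hd hn U₁ U₂).mp h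
    have hdet := congrArg det hU
    rw [det_smul, (mem_specialUnitaryGroup_iff.mp U₁.2).2,
      (mem_specialUnitaryGroup_iff.mp U₂.2).2, Fintype.card_fin, mul_one] at hdet
    have h1 : ζ = 1 := by
      have := pow_gcd_eq_one.mpr ⟨hζ, hdet.symm⟩
      rwa [hc, pow_one] at this
    exact Subtype.ext (by rw [hU, h1, one_smul])

lemma isDensity_ketbra_inputVec (hτ : IsTwoDesign τ) (hd : 1 ≤ d) :
    IsDensity (ketbra (inputVec n τ)) :=
  ⟨ketbra_posSemidef _, hτ.hasDesignMoments.trace_designVec hd⟩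

end Injectivity

/-! ### The asymptotic error -/

section Model

variable {d n dA : ℕ} {U : (Fin (d ^ 2 - 1) → ℝ) → specialUnitaryGroup (Fin d) ℂ}
  {θ : Fin (d ^ 2 - 1) → ℝ} {s : Fin (d ^ 2 - 1) → Matrix (Fin d) (Fin d) ℂ}

/-- The generator `𝟙_A ⊗ ∑ₖ X⁽ᵏ⁾` of the action on one output system. -/
def gen (dA n : ℕ) (X : Matrix (Fin d) (Fin d) ℂ) : Matrix (Idx dA d n) (Idx dA d n) ℂ :=
  (1 : Matrix (Fin dA) (Fin dA) ℂ) ⊗ₖ tensorSum n X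

/-- A logarithmic derivative of the output state `σ`, normalized to vanishing expectation, so that
the contributions of different copies are uncorrelated. -/
noncomputable def logDer (σ : Matrix (Idx dA d n) (Idx dA d n) ℂ) (X : Matrix (Fin d) (Fin d) ℂ) :
    Matrix (Idx dA d n) (Idx dA d n) ℂ :=
  -Complex.I • (gen dA n X - (gen dA n X * σ).trace • 1)

lemma conjTranspose_gen {X : Matrix (Fin d) (Fin d) ℂ} (hX : Xᴴ = X) :
    (gen dA n X)ᴴ = gen dA n X := by
  rw [gen, conjTranspose_kronecker, conjTranspose_one, conjTranspose_tensorSum, hX]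

variable {σ : Matrix (Idx dA d n) (Idx dA d n) ℂ} {X Y : Matrix (Fin d) (Fin d) ℂ}

lemma star_trace_gen (hσ : IsDensity σ) (hX : Xᴴ = X) :
    star (gen dA n X * σ).trace = (gen dA n X * σ).trace := by
  rw [← trace_conjTranspose, conjTranspose_mul, hσ.posSemidef.1.eq, conjTranspose_gen hX,
    trace_mul_comm]

lemma conjTranspose_logDer (hσ : IsDensity σ) (hX : Xᴴ = X) :
    (logDer σ X)ᴴ = Complex.I • (gen dA n X - (gen dA n X * σ).trace • 1) := by
  rw [logDer, conjTranspose_smul, conjTranspose_sub, conjTranspose_gen hX, conjTranspose_smul,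
    star_trace_gen hσ hX, conjTranspose_one]
  simp

lemma trace_logDer_mul (hσ : IsDensity σ) : (logDer σ X * σ).trace = 0 := by
  simp [logDer, Matrix.sub_mul, hσ.trace_eq_one]

lemma trace_logDer_mul_logDer (hσ : IsDensity σ) (hY : Yᴴ = Y) :
    (logDer σ X * σ * (logDer σ Y)ᴴ).trace = (gen dA n X * σ * gen dA n Y).trace -
      (gen dA n X * σ).trace * (gen dA n Y * σ).trace := by
  rw [conjTranspose_logDer hσ hY, logDer]
  simp only [Matrix.smul_mul, Matrix.mul_smul, smul_smul, Matrix.sub_mul, Matrix.mul_sub,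
    Matrix.one_mul, Matrix.mul_one, trace_smul, trace_sub, hσ.trace_eq_one, smul_eq_mul,
    trace_mul_comm σ]
  linear_combination (-(gen dA n X * σ * gen dA n Y).trace +
    (gen dA n X * σ).trace * (gen dA n Y * σ).trace) * Complex.I_mul_I

lemma conjTranspose_gate_mul (U : specialUnitaryGroup (Fin d) ℂ) :
    (gate dA n (U : Matrix (Fin d) (Fin d) ℂ))ᴴ * gate dA n (U : Matrix (Fin d) (Fin d) ℂ) = 1 := by
  rw [gate, conjTranspose_kronecker, conjTranspose_one, conjTranspose_tensorPow,
    ← mul_kronecker_mul, tensorPow_mul, coe_conjTranspose_mul, tensorPow_one, Matrix.one_mul,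
    one_kronecker_one]

lemma IsDensity.conj_gate {ω : Matrix (Idx dA d n) (Idx dA d n) ℂ} (hω : IsDensity ω)
    (U : specialUnitaryGroup (Fin d) ℂ) :
    IsDensity (gate dA n (U : Matrix (Fin d) (Fin d) ℂ) * ω *
      (gate dA n (U : Matrix (Fin d) (Fin d) ℂ))ᴴ) where
  posSemidef := hω.posSemidef.mul_mul_conjTranspose_same _
  trace_eq_one := by
    rw [Matrix.mul_assoc, trace_mul_comm, Matrix.mul_assoc, conjTranspose_gate_mul,
      Matrix.mul_one, hω.trace_eq_one]

lemma IsDensity.tensorPow {ι : Type} [Fintype ι] {σ : Matrix ι ι ℂ} (hσ : IsDensity σ) (N : ℕ) :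
    IsDensity (tensorPow N σ) where
  posSemidef := by
    classical
    open scoped MatrixOrder in
    obtain ⟨b, rfl⟩ := CStarAlgebra.nonneg_iff_eq_star_mul_self.mp hσ.posSemidef.nonneg
    rw [star_eq_conjTranspose, ← tensorPow_mul, ← conjTranspose_tensorPow]
    exact posSemidef_conjTranspose_mul_self _
  trace_eq_one := by rw [trace_tensorPow, hσ.trace_eq_one, one_pow]

/-- The output state of a single system at `θ`; the `N`-copy model is its tensor power. -/
def outputState (U : (Fin (d ^ 2 - 1) → ℝ) → specialUnitaryGroup (Fin d) ℂ)
    (θ : Fin (d ^ 2 - 1) → ℝ) (ω : Matrix (Idx dA d n) (Idx dA d n) ℂ) :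
    Matrix (Idx dA d n) (Idx dA d n) ℂ :=
  gate dA n (U θ : Matrix (Fin d) (Fin d) ℂ) * ω * (gate dA n (U θ : Matrix (Fin d) (Fin d) ℂ))ᴴ

lemma pderiv_outputModel (hs : IsGeneratorBasis s)
    (hU : ∀ α, HasEntryDeriv (fun t => (U (θ + t • Pi.single α 1) : Matrix (Fin d) (Fin d) ℂ))
      ((-Complex.I • s α) * (U θ : Matrix (Fin d) (Fin d) ℂ)))
    {ω : Matrix (Idx dA d n) (Idx dA d n) ℂ} (hω : IsDensity ω) (N : ℕ) (α : Fin (d ^ 2 - 1)) :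
    pderiv (outputModel n N U ω) θ α =
      tensorSum N (logDer (outputState U θ ω) (s α)) * outputModel n N U ω θ +
        outputModel n N U ω θ * (tensorSum N (logDer (outputState U θ ω) (s α)))ᴴ := by
  have h0 : θ + (0 : ℝ) • Pi.single α 1 = θ := by simp
  have hσ : IsDensity (outputState U θ ω) := hω.conj_gate (U θ)
  have h1 : HasEntryDeriv (fun t => gate dA n
      (U (θ + t • Pi.single α 1) : Matrix (Fin d) (Fin d) ℂ))
      ((-Complex.I • gen dA n (s α)) *
        gate dA n (U (θ + (0 : ℝ) • Pi.single α 1) : Matrix (Fin d) (Fin d) ℂ)) := by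
    have hUα := hU α
    rw [← h0] at hUα
    nth_rewrite 1 [h0] at hUα
    have := (HasEntryDeriv.tensorPow_left (X := -Complex.I • s α) hUα n).one_kronecker dA
    convert! this using 1
    rw [gen, gate, ← kronecker_smul, ← mul_kronecker_mul, Matrix.one_mul, tensorSum_smul]
  refine HasEntryDeriv.pderiv_eq ?_
  have h2 := (h1.conj ω)
  have h3 : (-Complex.I • gen dA n (s α)) * outputState U θ ω +
      outputState U θ ω * (-Complex.I • gen dA n (s α))ᴴ =
      logDer (outputState U θ ω) (s α) * outputState U θ ω +
        outputState U θ ω * (logDer (outputState U θ ω) (s α))ᴴ := by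
    rw [conjTranspose_logDer hσ (hs.hermitian α), logDer, conjTranspose_smul,
      conjTranspose_gen (hs.hermitian α)]
    simp only [Matrix.smul_mul, Matrix.mul_smul, Matrix.sub_mul, Matrix.mul_sub, Matrix.one_mul,
      Matrix.mul_one, star_neg, Complex.star_def, Complex.conj_I, neg_neg]
    module
  have h4 := HasEntryDeriv.tensorPow_add (X := logDer (outputState U θ ω) (s α))
    (B := fun t => outputState U (θ + t • Pi.single α 1) ω) (by
      simp only [h0]
      rw [← h3]
      simp only [h0] at h2
      exact h2) N
  simp only [h0] at h4
  exact h4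

/-- The value of the asymptotic error as the ratio of the number of parameters to a Fisher
information per parameter. -/
lemma error_value (hd : 1 ≤ d) (hn : 1 ≤ n) : (d : ℝ) * (d + 1) ^ 2 * (d - 1) / (4 * n * (n + d)) =
    ((d ^ 2 - 1 : ℕ) : ℝ) / (4 * (n * (n + d) / (d * (d + 1)))) := by
  have : 1 ≤ d ^ 2 := Nat.one_le_pow _ _ hd
  push_cast [Nat.cast_sub this]
  have hd0 : (d : ℝ) ≠ 0 := by positivity
  have hn0 : (n : ℝ) ≠ 0 := by positivity
  have hnd : (n : ℝ) + d ≠ 0 := by positivity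
  field_simp
  ring

lemma le_scaledError (hU : IsNormalizedAt U θ) (hd : 1 ≤ d) (hn : 1 ≤ n)
    {ω : Matrix (Idx dA d n) (Idx dA d n) ℂ} (hω : IsDensity ω) {N : ℕ} (hN : 1 ≤ N) :
    ENNReal.ofReal ((d : ℝ) * (d + 1) ^ 2 * (d - 1) / (4 * n * (n + d))) ≤
      scaledError n N U θ ω := by
  -- for `d = 1` there is no parameter and the bound is `0`, while the bound `t` below on the trace
  -- of the Fisher information is positive only for `d ≥ 2`
  rcases hd.eq_or_lt with rfl | hd1
  · simp
  obtain ⟨s, hs, hUs⟩ := hU.exists_generatorBasis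
  have hσ : IsDensity (outputState U θ ω) := hω.conj_gate (U θ)
  have hρ : IsDensity (outputModel n N U ω θ) := hσ.tensorPow N
  have hder := pderiv_outputModel hs hUs hω N
  set t : ℝ := 4 * (N * (n * (n + d) * (d - 1) / d)) with ht
  have hd1' : (0 : ℝ) < d - 1 := by
    rw [sub_pos]; exact_mod_cast hd1
  have ht0 : 0 < t := by positivity
  have htr (M : POVM (Fin N → Idx dA d n)) :
      (fisherInfo (outputModel n N U ω) θ M).trace ≤ t := by
    calc _ ≤ ∑ α, 4 * (N * (gen dA n (s α) * outputState U θ ω * gen dA n (s α)).trace.re) := by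
          refine Finset.sum_le_sum fun α _ => (fisherInfo_diag_le hρ.posSemidef hder M α).trans ?_
          have h := trace_tensorSum_mul_mul (N := N) hσ.trace_eq_one
            (logDer (outputState U θ ω) (s α)) (logDer (outputState U θ ω) (s α))ᴴ
          rw [trace_logDer_mul hσ, zero_mul, mul_zero, add_zero, ← conjTranspose_tensorSum,
            trace_logDer_mul_logDer hσ (hs.hermitian α)] at h
          have him := Complex.conj_eq_iff_im.mp (star_trace_gen hσ (hs.hermitian α))
          have hsq : 0 ≤ ((gen dA n (s α) * outputState U θ ω).trace *
              (gen dA n (s α) * outputState U θ ω).trace).re := by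
            rw [Complex.mul_re, him, mul_zero, sub_zero]
            exact mul_self_nonneg _
          have h' := congrArg Complex.re h
          rw [← Complex.ofReal_natCast, Complex.re_ofReal_mul, Complex.sub_re] at h'
          change 4 * (tensorSum N _ * tensorPow N (outputState U θ ω) * _).trace.re ≤ _
          rw [h']
          gcongr
          linarith
      _ ≤ t := by
          rw [← Finset.mul_sum, ← Finset.mul_sum, ht]
          gcongr
          exact hs.casimir_le hd hσ
  have hbound : ENNReal.ofReal ((d : ℝ) * (d + 1) ^ 2 * (d - 1) / (4 * n * (n + d))) =
      N * ENNReal.ofReal (((d ^ 2 - 1 : ℕ) : ℝ) ^ 2 / t) := by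
    rw [← ENNReal.ofReal_natCast, ← ENNReal.ofReal_mul (Nat.cast_nonneg N), error_value hd hn]
    congr 1
    have : 1 ≤ d ^ 2 := Nat.one_le_pow _ _ hd
    push_cast [Nat.cast_sub this]
    have hd0 : (d : ℝ) ≠ 0 := by positivity
    have hn0 : (n : ℝ) ≠ 0 := by positivity
    have hN0 : (N : ℝ) ≠ 0 := by positivity
    have hnd : (n : ℝ) + d ≠ 0 := by positivity
    rw [ht]
    field_simp
    ring
  rw [hbound, scaledError]
  gcongr
  exact le_iInf fun M => le_traceInv (fisherInfo_posSemidef hρ.posSemidef hder M) ht0 (htr M)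

lemma traceInv_smul_one {p : ℕ} {c : ℝ} (hc : 0 < c) :
    traceInv (c • (1 : Matrix (Fin p) (Fin p) ℝ)) = ENNReal.ofReal (p / c) := by
  have h1 : (c • (1 : Matrix (Fin p) (Fin p) ℝ))⁻¹ = c⁻¹ • 1 :=
    inv_eq_right_inv (by simp [smul_smul, hc.ne'])
  rw [traceInv, if_pos (by simp [hc.ne']), h1, trace_smul, trace_one, Fintype.card_fin,
    smul_eq_mul, div_eq_inv_mul]

lemma scaledError_le {m : ℕ} {τ : Fin m → EuclideanSpace ℂ (Fin d)} (hτ : IsTwoDesign τ)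
    (hU : IsNormalizedAt U θ) (hd : 1 ≤ d) (hn : 1 ≤ n) {N : ℕ} (hN : 1 ≤ N) :
    scaledError n N U θ (ketbra (inputVec n τ)) ≤
      ENNReal.ofReal ((d : ℝ) * (d + 1) ^ 2 * (d - 1) / (4 * n * (n + d))) := by
  obtain ⟨s, hs, hUs⟩ := hU.exists_generatorBasis
  have hω := isDensity_ketbra_inputVec (n := n) hτ hd
  have hv := hτ.hasDesignMoments.mulVec (coe_conjTranspose_mul (U θ))
  have hσ : IsDensity (outputState U θ (ketbra (inputVec n τ))) := hω.conj_gate (U θ)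
  have hσ' : outputState U θ (ketbra (inputVec n τ)) = ketbra (outputVec n τ (U θ)) :=
    (ketbra_mulVec _ _).symm
  have hder := pderiv_outputModel hs hUs hω N
  have hρ : outputModel n N U (ketbra (inputVec n τ)) θ =
      ketbra fun x => ∏ k, outputVec n τ (U θ) (x k) := by
    rw [← tensorPow_ketbra, ← hσ']
    rfl
  have hρ' : ketbra (fun x : Fin N → Idx m d n => ∏ k, outputVec n τ (U θ) (x k)) =
      tensorPow N (outputState U θ (ketbra (inputVec n τ))) := by
    rw [hσ', tensorPow_ketbra]
  -- `2` is not a square, as the measurement of `exists_fisherInfo_eq` requires; `d = 1` is allowed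
  have hp : d ^ 2 - 1 ≠ 1 := by
    intro h
    have h2 : d ^ 2 = 2 := by omega
    rcases (by omega : d = 1 ∨ 2 ≤ d) with rfl | h3
    · omega
    · nlinarith
  set κ : ℝ := n * (n + d) / (d * (d + 1)) with hκ
  have hκ0 : 0 < κ := by positivity
  have hgen (α) : (gen m n (s α) * outputState U θ (ketbra (inputVec n τ))).trace = 0 := by
    rw [hσ', outputVec_eq, gen, hv.trace_tensorSum hd, hs.trace_eq_zero]
    simp
  obtain ⟨M, hM⟩ := exists_fisherInfo_eq (κ := N * κ) hp (by positivity) hρ hder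
    (by rw [hρ']; exact (hσ.tensorPow N).trace_eq_one)
    (fun α => by rw [hρ', trace_tensorSum_mul hσ.trace_eq_one, trace_logDer_mul hσ, mul_zero])
    (fun α β => by
      rw [hρ', conjTranspose_tensorSum, trace_tensorSum_mul_mul hσ.trace_eq_one,
        trace_logDer_mul hσ, zero_mul, mul_zero, add_zero,
        trace_logDer_mul_logDer hσ (hs.hermitian β), hgen, zero_mul, sub_zero, hσ', outputVec_eq,
        gen, gen, hv.trace_tensorSum_tensorSum hd, hs.trace_eq_zero, hs.trace_mul]
      have hd0 : (d : ℂ) ≠ 0 := by exact_mod_cast (by omega : d ≠ 0)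
      have hd1 : (d : ℂ) + 1 ≠ 0 := by exact_mod_cast d.succ_ne_zero
      split_ifs
      · rw [hκ]
        push_cast
        field_simp
        ring
      · simp)
  calc scaledError n N U θ (ketbra (inputVec n τ))
      ≤ N * traceInv (fisherInfo (outputModel n N U (ketbra (inputVec n τ))) θ M) := by
        rw [scaledError]
        gcongr
        exact iInf_le _ M
    _ = _ := by
        rw [hM, traceInv_smul_one (by positivity), ← ENNReal.ofReal_natCast,
          ← ENNReal.ofReal_mul (Nat.cast_nonneg N), error_value hd hn, ← hκ]
        congr 1
        have hN0 : (N : ℝ) ≠ 0 := by positivity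
        field_simp

end Model

end SUEstimation

theorem theorem1 (d m n : ℕ) (hd : 1 ≤ d) (hn : 1 ≤ n)
    (τ : Fin m → EuclideanSpace ℂ (Fin d)) (hτ : SUEstimation.IsTwoDesign τ) :
    -- two output vectors agree up to a factor iff the two unitaries do
    (∀ U₁ U₂ : specialUnitaryGroup (Fin d) ℂ,
      (∃ c : ℂ, SUEstimation.outputVec n τ U₁ = c • SUEstimation.outputVec n τ U₂) ↔
        ∃ ζ : ℂ, (U₁ : Matrix (Fin d) (Fin d) ℂ) = ζ • (U₂ : Matrix (Fin d) (Fin d) ℂ)) ∧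
    -- two output vectors are equal iff the unitaries differ by an n-th root of unity
    (∀ U₁ U₂ : specialUnitaryGroup (Fin d) ℂ,
      SUEstimation.outputVec n τ U₁ = SUEstimation.outputVec n τ U₂ ↔
        ∃ ζ : ℂ, ζ ^ n = 1 ∧
          (U₁ : Matrix (Fin d) (Fin d) ℂ) = ζ • (U₂ : Matrix (Fin d) (Fin d) ℂ)) ∧
    -- in particular the map is injective on SU(d) itself exactly if gcd(n, d) = 1
    (Function.Injective (SUEstimation.outputVec n τ :
        specialUnitaryGroup (Fin d) ℂ → SUEstimation.Idx m d n → ℂ) ↔ Nat.Coprime n d) ∧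
    -- the input state is a state; its figure of merit (the limit exists), and its optimality
    SUEstimation.IsDensity (SUEstimation.ketbra (SUEstimation.inputVec n τ)) ∧
    (∀ (U : (Fin (d ^ 2 - 1) → ℝ) → specialUnitaryGroup (Fin d) ℂ) (θ : Fin (d ^ 2 - 1) → ℝ),
      SUEstimation.IsNormalizedAt U θ →
        Tendsto (fun N : ℕ => SUEstimation.scaledError n N U θ
            (SUEstimation.ketbra (SUEstimation.inputVec n τ))) atTop
          (𝓝 (ENNReal.ofReal
            ((d : ℝ) * (d + 1) ^ 2 * (d - 1) / (4 * n * (n + d))))) ∧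
        SUEstimation.figureOfMerit n U θ (SUEstimation.ketbra (SUEstimation.inputVec n τ)) =
          ENNReal.ofReal ((d : ℝ) * (d + 1) ^ 2 * (d - 1) / (4 * n * (n + d))) ∧
        ∀ (dA : ℕ) (ω : Matrix (SUEstimation.Idx dA d n) (SUEstimation.Idx dA d n) ℂ),
          SUEstimation.IsDensity ω →
            ENNReal.ofReal ((d : ℝ) * (d + 1) ^ 2 * (d - 1) / (4 * n * (n + d))) ≤
              SUEstimation.figureOfMerit n U θ ω) := by
  refine ⟨fun U₁ U₂ => ⟨fun ⟨c, h⟩ => SUEstimation.exists_eq_smul_of_outputVec hτ hd hn h,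
    fun ⟨ζ, h⟩ => ⟨ζ ^ n, SUEstimation.outputVec_smul h⟩⟩,
    SUEstimation.outputVec_eq_iff hτ hd hn, SUEstimation.outputVec_injective_iff hτ hd hn,
    SUEstimation.isDensity_ketbra_inputVec hτ hd, fun U θ hU => ?_⟩
  have hlim : Tendsto (fun N : ℕ => SUEstimation.scaledError n N U θ
      (SUEstimation.ketbra (SUEstimation.inputVec n τ))) atTop
      (𝓝 (ENNReal.ofReal ((d : ℝ) * (d + 1) ^ 2 * (d - 1) / (4 * n * (n + d))))) := by
    refine tendsto_const_nhds.congr' ?_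
    filter_upwards [eventually_ge_atTop 1] with N hN
    exact (SUEstimation.le_scaledError hU hd hn
      (SUEstimation.isDensity_ketbra_inputVec hτ hd) hN).antisymm
      (SUEstimation.scaledError_le hτ hU hd hn hN)
  refine ⟨hlim, hlim.liminf_eq, fun dA ω hω => le_liminf_of_le (by isBoundedDefault) ?_⟩
  filter_upwards [eventually_ge_atTop 1] with N hN
  exact SUEstimation.le_scaledError hU hd hn hω hN
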